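/- Let $C$ be a smooth complex projective curve, i.e. a connected compact Riemann surface (it is not necessary to assume that $C$ is non-hyperelliptic), and let $C_2=(C\times C)/S_2$ be its symmetric square, a smooth complex surface with quotient map $\pi:C\times C\to C_2$, $(p,q)\mapsto p+q$. A holomorphic $1$-form $\Omega\in H^{1,0}(C_2)$ corresponds to $\omega\in H^{1,0}(C)$ if $\pi^*\Omega=\mathrm{pr}_1^*\omega+\mathrm{pr}_2^*\omega$. Let $V\subset H^{1,0}(C)$ be a subspace of dimension $3$, let $W\subset H^{1,0}(C_2)$ be the space of forms that correspond to elements of $V$, and let $W^2\subset H^{2,0}(C_2)$ be the image of $\bigwedge^2W$, i.e. the span of the forms $\Omega\wedge\Omega'$ with $\Omega,\Omega'\in W$. Let $B_{W^2}\subset C_2$ be the base locus of the linear system $|W^2|$, i.e. the set of common zeros of the $2$-forms in $W^2$. 1. If $p\in C$ is a base point of $V$ (i.e. $\omega(p)=0$ for all $\omega\in V$), then the curve $C_p=\{p+q : q\in C\}$ is contained in $B_{W^2}$. 2. Suppose that $V$ is base-point-free and that the induced map $\varphi_V:C\to\mathbb P(V^*)\cong\mathbb P^2$, $\varphi_V(p)=[\omega\mapsto\omega(p)]$,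 is birational onto its image (equivalently, injective outside a finite set). Then $B_{W^2}$ is finite. Moreover $B_{W^2}$ consists exactly of the points $p+q$ with $p\neq q$ and $\varphi_V(p)=\varphi_V(q)$ (the "nodes" of the plane curve $\varphi_V(C)$, i.e. its pairs of branches with a common point) and the points $2p$ such that the differential of $\varphi_V$ vanishes at $p$ (the "cusps"). -/

import Mathlib

open scoped Manifold ContDiff Topology
open Set

namespace SymSq

/-! ### The symmetric square `C₂` of a Riemann surface `C` as a complex surface

The underlying space is `Sym2 C`, with the quotient topology from `C × C`. -/

/-- The elementary symmetric functions `{z, w} ↦ (z + w, z w)`. -/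
def esymm : Sym2 ℂ → ℂ × ℂ :=
  Sym2.lift ⟨fun z w => (z + w, z * w), fun z w => by ext <;> simp [add_comm, mul_comm]⟩

@[simp] theorem esymm_mk (z w : ℂ) : esymm s(z, w) = (z + w, z * w) := rfl

theorem esymm_bijective : Function.Bijective esymm := by
  constructor
  · intro D D'
    induction D with | h z w => ?_
    induction D' with | h z' w' => ?_
    intro h
    simp only [esymm_mk, Prod.mk.injEq] at h
    obtain ⟨h1, h2⟩ := h
    have h3 : (z - z') * (z - w') = 0 := by linear_combination z * h1 - h2
    simp only [Sym2.eq, Sym2.rel_iff]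
    rcases mul_eq_zero.1 h3 with h | h
    · left
      have : z = z' := sub_eq_zero.1 h
      subst this
      exact ⟨rfl, by simpa using h1⟩
    · right
      have : z = w' := sub_eq_zero.1 h
      subst this
      refine ⟨rfl, ?_⟩
      linear_combination h1
  · rintro ⟨s, t⟩
    obtain ⟨d, hd⟩ := IsAlgClosed.exists_pow_nat_eq (s ^ 2 - 4 * t) (n := 2) (by norm_num)
    refine ⟨s((s + d) / 2, (s - d) / 2), ?_⟩
    rw [esymm_mk]
    ext
    · ring
    · simp only
      linear_combination (-1 / 4 : ℂ) * hd

theorem continuous_mk (X : Type*) [TopologicalSpace X] :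
    Continuous (fun x : X × X => s(x.1, x.2)) :=
  continuous_quot_mk

theorem isQuotientMap_mk (X : Type*) [TopologicalSpace X] :
    Topology.IsQuotientMap (fun x : X × X => s(x.1, x.2)) :=
  isQuotientMap_quot_mk

theorem isOpenMap_mk (X : Type*) [TopologicalSpace X] :
    IsOpenMap (fun x : X × X => s(x.1, x.2)) := by
  intro U hU
  rw [← (isQuotientMap_mk X).isOpen_preimage]
  have : (fun x : X × X => s(x.1, x.2)) ⁻¹' ((fun x : X × X => s(x.1, x.2)) '' U)
      = U ∪ Prod.swap ⁻¹' U := by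
    ext ⟨x, y⟩
    simp only [mem_preimage, mem_image, Sym2.eq, Sym2.rel_iff, Prod.exists, mem_union, Prod.swap]
    constructor
    · rintro ⟨a, b, h, ⟨rfl, rfl⟩ | ⟨rfl, rfl⟩⟩
      · exact Or.inl h
      · exact Or.inr h
    · rintro (h | h)
      · exact ⟨x, y, h, Or.inl ⟨rfl, rfl⟩⟩
      · exact ⟨y, x, h, Or.inr ⟨rfl, rfl⟩⟩
  rw [this]
  exact hU.union (hU.preimage continuous_swap)

theorem continuous_esymm : Continuous esymm :=
  (isQuotientMap_mk ℂ).continuous_iff.2 (by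
    change Continuous fun x : ℂ × ℂ => (x.1 + x.2, x.1 * x.2)
    fun_prop)

theorem isClosedMap_esymm : IsClosedMap esymm := by
  have hp : IsProperMap (fun x : ℂ × ℂ => (x.1 + x.2, x.1 * x.2)) := by
    rw [isProperMap_iff_tendsto_cocompact]
    refine ⟨by fun_prop, ?_⟩
    rw [← Metric.cobounded_eq_cocompact, ← tendsto_norm_atTop_iff_cobounded]
    have key : ∀ x : ℂ × ℂ, ‖x‖ ≤ 1 + 2 * ‖((x.1 + x.2, x.1 * x.2) : ℂ × ℂ)‖ := by
      have aux : ∀ z w : ℂ, ‖z‖ ≤ 1 + 2 * ‖((z + w, z * w) : ℂ × ℂ)‖ := by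
        intro z w
        set R := ‖((z + w, z * w) : ℂ × ℂ)‖
        have h1 : ‖z + w‖ ≤ R := norm_fst_le ((z + w, z * w) : ℂ × ℂ)
        have h2 : ‖z * w‖ ≤ R := norm_snd_le ((z + w, z * w) : ℂ × ℂ)
        have h3 : ‖z‖ ^ 2 ≤ ‖z‖ * R + R := by
          calc ‖z‖ ^ 2 = ‖z * (z + w) - z * w‖ := by
                rw [← norm_pow]; congr 1; ring
            _ ≤ ‖z * (z + w)‖ + ‖z * w‖ := norm_sub_le _ _
            _ ≤ _ := by rw [norm_mul]; gcongr
        have hR : 0 ≤ R := norm_nonneg _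
        nlinarith [norm_nonneg z]
      rintro ⟨z, w⟩
      refine max_le (aux z w) ?_
      have := aux w z
      rwa [add_comm w z, mul_comm w z] at this
    refine Filter.tendsto_atTop.2 fun b => ?_
    filter_upwards [(tendsto_norm_cobounded_atTop (E := ℂ × ℂ)).eventually_ge_atTop (1 + 2 * b)]
      with x hx
    linarith [key x]
  intro K hK
  have := hp.isClosedMap _ (hK.preimage (continuous_mk ℂ))
  convert this using 1
  ext y
  constructor
  · rintro ⟨D, hD, rfl⟩
    induction D with | h z w => exact ⟨(z, w), hD, rfl⟩
  · rintro ⟨⟨z, w⟩, hD, rfl⟩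
    exact ⟨s(z, w), hD, rfl⟩

/-- The homeomorphism of the symmetric square of `ℂ` with `ℂ²`. -/
noncomputable def esymmHomeo : Sym2 ℂ ≃ₜ ℂ × ℂ :=
  (Equiv.ofBijective esymm esymm_bijective).toHomeomorphOfContinuousClosed
    continuous_esymm isClosedMap_esymm

theorem esymmHomeo_mk (z w : ℂ) : esymmHomeo s(z, w) = (z + w, z * w) := rfl

theorem isOpenMap_elem : IsOpenMap (fun x : ℂ × ℂ => (x.1 + x.2, x.1 * x.2)) :=
  esymmHomeo.isOpenMap.comp (isOpenMap_mk ℂ)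

section Analytic

theorem exists_analytic_of_ne (h : ℂ → ℂ) (z₀ w₀ : ℂ) (hne : z₀ ≠ w₀)
    (hz : AnalyticAt ℂ h z₀) (hw : AnalyticAt ℂ h w₀) :
    ∃ G : ℂ × ℂ → ℂ, AnalyticAt ℂ G (z₀ + w₀, z₀ * w₀) ∧
      ∀ᶠ x : ℂ × ℂ in 𝓝 (z₀, w₀), G (x.1 + x.2, x.1 * x.2) = h x.1 + h x.2 := by
  let σ : ℂ × ℂ → ℂ × ℂ := fun x => (x.1 + x.2, x.1 * x.2)
  have hσ : ContDiff ℂ ω σ := by fun_prop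
  let A : (ℂ × ℂ) →L[ℂ] (ℂ × ℂ) :=
    (ContinuousLinearMap.fst ℂ ℂ ℂ + ContinuousLinearMap.snd ℂ ℂ ℂ).prod
      (z₀ • ContinuousLinearMap.snd ℂ ℂ ℂ + w₀ • ContinuousLinearMap.fst ℂ ℂ ℂ)
  have hA : HasFDerivAt σ A (z₀, w₀) :=
    (hasFDerivAt_fst.add hasFDerivAt_snd).prodMk
      (HasFDerivAt.mul (𝕜 := ℂ) (c := fun x : ℂ × ℂ => x.1) (d := fun x : ℂ × ℂ => x.2)
        (x := (z₀, w₀)) hasFDerivAt_fst hasFDerivAt_snd)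
  have hA_apply : ∀ x, A x = (x.1 + x.2, z₀ * x.2 + w₀ * x.1) := fun x => rfl
  have hd : z₀ - w₀ ≠ 0 := sub_ne_zero.2 hne
  have hker : A.ker = ⊥ := by
    rw [LinearMap.ker_eq_bot']
    rintro ⟨a, b⟩ hab
    have hab' : (a + b, z₀ * b + w₀ * a) = ((0, 0) : ℂ × ℂ) := hab
    simp only [Prod.mk.injEq] at hab'
    have hb : (z₀ - w₀) * b = 0 := by linear_combination hab'.2 - w₀ * hab'.1
    have hb0 : b = 0 := (mul_eq_zero.1 hb).resolve_left hd
    have ha0 : a = 0 := by simpa [hb0] using hab'.1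
    rw [ha0, hb0]; rfl
  have hran : A.range = ⊤ := LinearMap.range_eq_top.2
    (LinearMap.injective_iff_surjective.1 (LinearMap.ker_eq_bot.1 hker))
  let A' : (ℂ × ℂ) ≃L[ℂ] (ℂ × ℂ) := ContinuousLinearEquiv.ofBijective A hker hran
  have hA' : HasFDerivAt σ (A' : (ℂ × ℂ) →L[ℂ] (ℂ × ℂ)) (z₀, w₀) := hA
  have hn : (ω : WithTop ℕ∞) ≠ 0 := by simp
  have hcd : ContDiffAt ℂ ω σ (z₀, w₀) := hσ.contDiffAt
  let e := hcd.toOpenPartialHomeomorph σ hA' hn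
  have hL : ContDiffAt ℂ ω (hcd.localInverse hA' hn) (σ (z₀, w₀)) := hcd.to_localInverse hA' hn
  have hleft : ∀ᶠ x in 𝓝 (z₀, w₀), hcd.localInverse hA' hn (σ x) = x :=
    e.eventually_left_inverse (hcd.mem_toOpenPartialHomeomorph_source hA' hn)
  have hLa : AnalyticAt ℂ (hcd.localInverse hA' hn) (σ (z₀, w₀)) := hL.analyticAt
  have h0 : hcd.localInverse hA' hn (σ (z₀, w₀)) = (z₀, w₀) := hleft.self_of_nhds
  refine ⟨fun y => h (hcd.localInverse hA' hn y).1 + h (hcd.localInverse hA' hn y).2, ?_, ?_⟩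
  · refine AnalyticAt.add ?_ ?_
    · refine AnalyticAt.comp (g := h) (f := fun y => (hcd.localInverse hA' hn y).1) ?_ ?_
      · change AnalyticAt ℂ h (hcd.localInverse hA' hn (σ (z₀, w₀))).1
        rwa [h0]
      · exact analyticAt_fst.comp hLa
    · refine AnalyticAt.comp (g := h) (f := fun y => (hcd.localInverse hA' hn y).2) ?_ ?_
      · change AnalyticAt ℂ h (hcd.localInverse hA' hn (σ (z₀, w₀))).2
        rwa [h0]
      · exact analyticAt_snd.comp hLa
  · filter_upwards [hleft] with x hx
    change h (hcd.localInverse hA' hn (σ x)).1 + h (hcd.localInverse hA' hn (σ x)).2 = _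
    rw [hx]


theorem banach_aux {A : Type*} [NormedRing A] [NormedAlgebra ℂ A] [CompleteSpace A]
    [NormOneClass A] {h : ℂ → ℂ} {c : ℂ} {p : FormalMultilinearSeries ℂ ℂ ℂ} {R : ENNReal}
    (hp : HasFPowerSeriesOnBall h p c R) :
    ∃ F : A → A, AnalyticOnNhd ℂ F (Metric.eball 0 R) ∧
      ∀ N ∈ Metric.eball (0 : A) R, HasSum (fun n => p.coeff n • N ^ n) (F N) := by
  have hrad : R ≤ (FormalMultilinearSeries.ofScalars A p.coeff).radius := by
    refine hp.r_le.trans (FormalMultilinearSeries.radius_le_of_le fun {n} => ?_)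
    rw [FormalMultilinearSeries.ofScalars_norm, ← FormalMultilinearSeries.norm_apply_eq_norm_coef]
  have hF := ((FormalMultilinearSeries.ofScalars A p.coeff).hasFPowerSeriesOnBall
    (hp.r_pos.trans_le hrad)).mono hp.r_pos hrad
  refine ⟨(FormalMultilinearSeries.ofScalars A p.coeff).sum, hF.analyticOnNhd, fun N hN => ?_⟩
  have := hF.hasSum hN
  simpa only [FormalMultilinearSeries.ofScalars_apply_eq, zero_add] using this

attribute [local instance] Matrix.linftyOpNormedRing Matrix.linftyOpNormedAlgebra

theorem trace_pow_aux (m δ ε z w : ℂ) (hε : ε ≠ 0) (hs : z + w = 2 * m) (ht : z * w = m ^ 2 - δ)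
    (n : ℕ) : (!![m, δ / ε; ε, m] ^ n).trace = z ^ n + w ^ n := by
  induction n using Nat.strong_induction_on with
  | _ n ih =>
    match n with
    | 0 => simp; norm_num
    | 1 => simp [Matrix.trace_fin_two, hs]; ring
    | k + 2 =>
      have hCH : (!![m, δ / ε; ε, m] : Matrix (Fin 2) (Fin 2) ℂ) ^ 2
          = (z + w) • !![m, δ / ε; ε, m] - (z * w) • (1 : Matrix (Fin 2) (Fin 2) ℂ) := by
        rw [hs, ht, pow_two]
        ext i j
        fin_cases i <;> fin_cases j <;> simp [Matrix.mul_apply, Fin.sum_univ_two] <;>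
          field_simp <;> ring
      rw [pow_add, hCH, mul_sub, Matrix.mul_smul, Matrix.mul_smul, mul_one, ← pow_succ,
        Matrix.trace_sub, Matrix.trace_smul, Matrix.trace_smul, ih (k + 1) (by omega),
        ih k (by omega), smul_eq_mul, smul_eq_mul]
      ring

theorem exists_analytic_of_eq (h : ℂ → ℂ) (c : ℂ) (hc : AnalyticAt ℂ h c) :
    ∃ G : ℂ × ℂ → ℂ, AnalyticAt ℂ G (c + c, c * c) ∧
      ∀ᶠ x : ℂ × ℂ in 𝓝 (c, c), G (x.1 + x.2, x.1 * x.2) = h x.1 + h x.2 := by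
  obtain ⟨p, R, hp⟩ := hc
  obtain ⟨ε, hε0, hεR⟩ : ∃ ε : NNReal, 0 < ε ∧ (ε : ENNReal) < R := by
    obtain ⟨ε, h1, h2⟩ := ENNReal.lt_iff_exists_nnreal_btwn.1 hp.r_pos
    exact ⟨ε, by simpa using h1, h2⟩
  have hε : ((ε : ℝ) : ℂ) ≠ 0 := by exact_mod_cast hε0.ne'
  obtain ⟨F, hF, hsum⟩ := banach_aux (A := Matrix (Fin 2) (Fin 2) ℂ) hp
  let N : ℂ × ℂ → Matrix (Fin 2) (Fin 2) ℂ := fun y =>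
    !![y.1 / 2 - c, ((y.1 / 2) ^ 2 - y.2) / (ε : ℝ); ((ε : ℝ) : ℂ), y.1 / 2 - c]
  have hNeq : N = fun y => (y.1 / 2 - c) • (1 : Matrix (Fin 2) (Fin 2) ℂ)
      + (((y.1 / 2) ^ 2 - y.2) / ((ε : ℝ) : ℂ)) • !![0, 1; 0, 0] + ((ε : ℝ) : ℂ) • !![0, 0; 1, 0] := by
    funext y
    ext i j
    fin_cases i <;> fin_cases j <;> simp [N]
  have hN : ∀ y, AnalyticAt ℂ N y := by
    intro y
    rw [hNeq]
    have h1 : AnalyticAt ℂ (fun y : ℂ × ℂ => y.1 / 2 - c) y :=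
      (analyticAt_fst.div analyticAt_const two_ne_zero).sub analyticAt_const
    have h2 : AnalyticAt ℂ (fun y : ℂ × ℂ => ((y.1 / 2) ^ 2 - y.2) / ((ε : ℝ) : ℂ)) y :=
      (((analyticAt_fst.div analyticAt_const two_ne_zero).pow 2).sub analyticAt_snd).div
        analyticAt_const hε
    exact ((h1.smul analyticAt_const).add (h2.smul analyticAt_const)).add analyticAt_const
  have hN0 : N (c + c, c * c) ∈ Metric.eball 0 R := by
    have hN1 : N (c + c, c * c) = !![0, 0; ((ε : ℝ) : ℂ), 0] := by
      ext i j
      fin_cases i <;> fin_cases j <;> (simp [N]; try ring_nf; simp)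
    rw [hN1, mem_eball_zero_iff]
    refine lt_of_le_of_lt ?_ hεR
    change ((‖(!![0, 0; ((ε : ℝ) : ℂ), 0] : Matrix (Fin 2) (Fin 2) ℂ)‖₊ : NNReal) : ENNReal) ≤ _
    rw [ENNReal.coe_le_coe, Matrix.linfty_opNNNorm_def]
    refine Finset.sup_le fun i _ => ?_
    fin_cases i <;> simp
  let τ : Matrix (Fin 2) (Fin 2) ℂ →L[ℂ] ℂ :=
    LinearMap.toContinuousLinearMap (Matrix.traceLinearMap (Fin 2) ℂ ℂ)
  refine ⟨fun y => τ (F (N y)), ?_, ?_⟩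
  · exact (τ.analyticAt _).comp ((hF _ hN0).comp (hN _))
  · have h1 : ∀ᶠ x : ℂ × ℂ in 𝓝 (c, c), N (x.1 + x.2, x.1 * x.2) ∈ Metric.eball 0 R := by
      have hcont : ContinuousAt (fun x : ℂ × ℂ => N (x.1 + x.2, x.1 * x.2)) (c, c) :=
        ContinuousAt.comp (g := N) (hN _).continuousAt (by fun_prop)
      exact hcont.eventually_mem (Metric.isOpen_eball.mem_nhds hN0)
    have h2 : ∀ᶠ x : ℂ × ℂ in 𝓝 (c, c), x.1 ∈ Metric.eball c R :=
      continuousAt_fst.eventually_mem (Metric.isOpen_eball.mem_nhds (Metric.mem_eball_self hp.r_pos))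
    have h3 : ∀ᶠ x : ℂ × ℂ in 𝓝 (c, c), x.2 ∈ Metric.eball c R :=
      continuousAt_snd.eventually_mem (Metric.isOpen_eball.mem_nhds (Metric.mem_eball_self hp.r_pos))
    filter_upwards [h1, h2, h3] with x hx1 hx2 hx3
    have e1 := τ.hasSum (hsum _ hx1)
    have s1 := (hp.hasSum_sub hx2).add (hp.hasSum_sub hx3)
    have hfun : (fun n => τ (p.coeff n • N (x.1 + x.2, x.1 * x.2) ^ n))
        = fun n => (p n fun _ => x.1 - c) + (p n fun _ => x.2 - c) := by
      funext n
      have ht := trace_pow_aux ((x.1 + x.2) / 2 - c) (((x.1 + x.2) / 2) ^ 2 - x.1 * x.2) (ε : ℝ)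
        (x.1 - c) (x.2 - c) hε (by ring) (by ring) n
      have ht' : τ (N (x.1 + x.2, x.1 * x.2) ^ n) = (x.1 - c) ^ n + (x.2 - c) ^ n := ht
      rw [map_smul, ht', FormalMultilinearSeries.apply_eq_pow_smul_coeff,
        FormalMultilinearSeries.apply_eq_pow_smul_coeff]
      simp only [smul_eq_mul]
      ring
    rw [hfun] at e1
    exact e1.unique s1

/-- Symmetric functions of two variables that come from one holomorphic function are holomorphic
functions of the elementary symmetric functions. -/
theorem analyticAt_symm_sum (h : ℂ → ℂ) (z₀ w₀ : ℂ)
    (hz : AnalyticAt ℂ h z₀) (hw : AnalyticAt ℂ h w₀) (S : ℂ × ℂ → ℂ)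
    (hS : ∀ᶠ x : ℂ × ℂ in 𝓝 (z₀, w₀), S (x.1 + x.2, x.1 * x.2) = h x.1 + h x.2) :
    AnalyticAt ℂ S (z₀ + w₀, z₀ * w₀) := by
  obtain ⟨G, hG, hGS⟩ : ∃ G : ℂ × ℂ → ℂ, AnalyticAt ℂ G (z₀ + w₀, z₀ * w₀) ∧
      ∀ᶠ x : ℂ × ℂ in 𝓝 (z₀, w₀), G (x.1 + x.2, x.1 * x.2) = h x.1 + h x.2 := by
    by_cases hne : z₀ = w₀
    · subst hne
      exact exists_analytic_of_eq h z₀ hz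
    · exact exists_analytic_of_ne h z₀ w₀ hne hz hw
  refine hG.congr ?_
  have := isOpenMap_elem.image_mem_nhds (hS.and hGS)
  filter_upwards [this]
  rintro _ ⟨x, ⟨h1, h2⟩, rfl⟩
  exact h2.trans h1.symm

end Analytic

section Charts

variable {X Y : Type*} [TopologicalSpace X] [TopologicalSpace Y]

theorem isOpen_pairs {U : Set X} (hU : IsOpen U) : IsOpen {D : Sym2 X | ∀ x ∈ D, x ∈ U} := by
  rw [← (isQuotientMap_mk X).isOpen_preimage]
  convert hU.prod hU using 1
  ext ⟨x, y⟩
  simp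

theorem continuousOn_map {f : X → Y} {U : Set X} (hU : IsOpen U) (hf : ContinuousOn f U) :
    ContinuousOn (Sym2.map f) {D : Sym2 X | ∀ x ∈ D, x ∈ U} := by
  refine ((isQuotientMap_mk X).continuousOn_isOpen_iff (isOpen_pairs hU)).2 ?_
  have h1 : ContinuousOn (fun x : X × X => (f x.1, f x.2))
      ((fun x : X × X => s(x.1, x.2)) ⁻¹' {D : Sym2 X | ∀ x ∈ D, x ∈ U}) := by
    refine ContinuousOn.prodMk (hf.comp continuousOn_fst ?_) (hf.comp continuousOn_snd ?_) <;>
    · rintro ⟨x, y⟩ h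
      simp only [mem_preimage, mem_ofPred_eq] at h
      apply h
      simp
  exact (continuous_mk Y).comp_continuousOn h1

/-- A local homeomorphism `f` induces `{x, y} ↦ {f x, f y}` on unordered pairs. -/
def mapChart (f : OpenPartialHomeomorph X Y) : OpenPartialHomeomorph (Sym2 X) (Sym2 Y) where
  toFun := Sym2.map f
  invFun := Sym2.map f.symm
  source := {D | ∀ x ∈ D, x ∈ f.source}
  target := {D | ∀ y ∈ D, y ∈ f.target}
  map_source' := by
    intro D hD y hy
    obtain ⟨x, hx, rfl⟩ := Sym2.mem_map.1 hy
    exact f.map_source (hD x hx)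
  map_target' := by
    intro D hD y hy
    obtain ⟨x, hx, rfl⟩ := Sym2.mem_map.1 hy
    exact f.map_target (hD x hx)
  left_inv' := by
    intro D hD
    rw [Sym2.map_map]
    exact (Sym2.map_congr fun x hx => f.left_inv (hD x hx)).trans (congrFun Sym2.map_id' D)
  right_inv' := by
    intro D hD
    rw [Sym2.map_map]
    exact (Sym2.map_congr fun x hx => f.right_inv (hD x hx)).trans (congrFun Sym2.map_id' D)
  open_source := isOpen_pairs f.open_source
  open_target := isOpen_pairs f.open_target
  continuousOn_toFun := continuousOn_map f.open_source f.continuousOn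
  continuousOn_invFun := continuousOn_map f.open_target f.symm.continuousOn

/-- The chart `{x, y} ↦ (f x + f y, f x * f y)` of the symmetric square attached to a chart `f`. -/
noncomputable def symChart (f : OpenPartialHomeomorph X ℂ) :
    OpenPartialHomeomorph (Sym2 X) (ℂ × ℂ) :=
  (mapChart f).transHomeomorph esymmHomeo

theorem symChart_source (f : OpenPartialHomeomorph X ℂ) :
    (symChart f).source = {D | ∀ x ∈ D, x ∈ f.source} := rfl

theorem symChart_mk (f : OpenPartialHomeomorph X ℂ) (x y : X) :
    symChart f s(x, y) = (f x + f y, f x * f y) := rfl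

theorem symChart_symm (f : OpenPartialHomeomorph X ℂ) (z w : ℂ) :
    (symChart f).symm (z + w, z * w) = s(f.symm z, f.symm w) := by
  change Sym2.map f.symm (esymmHomeo.symm (z + w, z * w)) = _
  rw [← esymmHomeo_mk, Homeomorph.symm_apply_apply]
  rfl

theorem mem_symChart_target (f : OpenPartialHomeomorph X ℂ) (z w : ℂ) :
    (z + w, z * w) ∈ (symChart f).target ↔ z ∈ f.target ∧ w ∈ f.target := by
  change esymmHomeo.symm (z + w, z * w) ∈ (mapChart f).target ↔ _
  rw [← esymmHomeo_mk, Homeomorph.symm_apply_apply]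
  change (∀ y ∈ s(z, w), y ∈ f.target) ↔ _
  simp

end Charts

section Manifold

variable (C : Type*) [TopologicalSpace C] [ChartedSpace ℂ C] [IsManifold 𝓘(ℂ) ω C]

/-- Coordinate changes between charts of the symmetric square are holomorphic. -/
theorem symChart_contDiffOn (f g : OpenPartialHomeomorph C ℂ)
    (hf : f ∈ IsManifold.maximalAtlas 𝓘(ℂ) ω C) (hg : g ∈ IsManifold.maximalAtlas 𝓘(ℂ) ω C) :
    ContDiffOn ℂ ω ((symChart f).symm.trans (symChart g))
      ((symChart f).symm.trans (symChart g)).source := by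
  have hfg := contMDiffOn_iff_contDiffOn.1 (contMDiffOn_of_mem_contDiffGroupoid
    (IsManifold.compatible_of_mem_maximalAtlas hf hg))
  let k : ℂ → ℂ := g ∘ f.symm
  have hk : ∀ z ∈ (f.symm.trans g).source, AnalyticAt ℂ k z := fun z hz =>
    (hfg.contDiffAt ((f.symm.trans g).open_source.mem_nhds hz)).analyticAt
  intro y hy
  obtain ⟨D, rfl⟩ := esymmHomeo.surjective y
  induction D with | h z₀ w₀ => ?_
  rw [esymmHomeo_mk] at hy ⊢
  let T : ℂ × ℂ → ℂ × ℂ := symChart g ∘ (symChart f).symm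
  have hTk : ∀ x : ℂ × ℂ, T (x.1 + x.2, x.1 * x.2) = (k x.1 + k x.2, k x.1 * k x.2) := by
    intro x
    change symChart g ((symChart f).symm (x.1 + x.2, x.1 * x.2)) = _
    rw [symChart_symm, symChart_mk]
    rfl
  obtain ⟨hy1, hy2⟩ := hy
  have hzw : z₀ ∈ f.target ∧ w₀ ∈ f.target := (mem_symChart_target f z₀ w₀).1 hy1
  have hy3 : ∀ x ∈ s(f.symm z₀, f.symm w₀), x ∈ g.source := by
    have : (symChart f).symm (z₀ + w₀, z₀ * w₀) ∈ (symChart g).source := hy2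
    rwa [symChart_symm] at this
  have hz : AnalyticAt ℂ k z₀ := hk z₀ ⟨hzw.1, hy3 _ (by simp)⟩
  have hw : AnalyticAt ℂ k w₀ := hk w₀ ⟨hzw.2, hy3 _ (by simp)⟩
  have hS1 : AnalyticAt ℂ (fun y => (T y).1) (z₀ + w₀, z₀ * w₀) :=
    analyticAt_symm_sum k z₀ w₀ hz hw _ (Filter.Eventually.of_forall fun x => by
      simp only [hTk])
  have hS2 : AnalyticAt ℂ (fun y => (T y).1 ^ 2 - 2 * (T y).2) (z₀ + w₀, z₀ * w₀) :=
    analyticAt_symm_sum (fun z => k z ^ 2) z₀ w₀ (hz.pow 2) (hw.pow 2) _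
      (Filter.Eventually.of_forall fun x => by simp only [hTk]; ring)
  have hS3 : AnalyticAt ℂ (fun y => (T y).2) (z₀ + w₀, z₀ * w₀) := by
    have h := ((hS1.pow 2).sub hS2).div (analyticAt_const (v := (2 : ℂ))) two_ne_zero
    refine h.congr (Filter.Eventually.of_forall fun y => ?_)
    simp
  have hS : AnalyticAt ℂ T (z₀ + w₀, z₀ * w₀) := hS1.prod hS3
  exact hS.contDiffAt.contDiffWithinAt

variable {C}

theorem exists_small_chart (p : C) {A : Set C} (hA : IsOpen A) (hp : p ∈ A) (b : ℂ) :
    ∃ φ ∈ IsManifold.maximalAtlas 𝓘(ℂ) ω C,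
      p ∈ φ.source ∧ φ.source ⊆ A ∧ φ.target ⊆ Metric.ball b 1 := by
  let e := chartAt ℂ p
  let t : ℂ ≃ₜ ℂ := Homeomorph.addRight (b - e p)
  let e' := e.transHomeomorph t
  have he' : e' ∈ IsManifold.maximalAtlas 𝓘(ℂ) ω C := by
    refine OpenPartialHomeomorph.mem_maximalAtlas_of_contMDiffOn _ ?_ ?_
    · have h1 : ContMDiff 𝓘(ℂ) 𝓘(ℂ) ω t := (contDiff_id.add contDiff_const).contMDiff
      exact h1.comp_contMDiffOn
        (contMDiffOn_of_mem_maximalAtlas (IsManifold.chart_mem_maximalAtlas p))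
    · have h1 : ContMDiff 𝓘(ℂ) 𝓘(ℂ) ω t.symm := by
        have : ContDiff ℂ ω t.symm := contDiff_id.add contDiff_const
        exact this.contMDiff
      exact (contMDiffOn_symm_of_mem_maximalAtlas (IsManifold.chart_mem_maximalAtlas p)).comp
        h1.contMDiffOn (fun x hx => hx)
  have hb : e' p = b := by
    change e p + (b - e p) = b
    ring
  let s : Set C := A ∩ (e'.source ∩ e' ⁻¹' Metric.ball b 1)
  have hs : IsOpen s := hA.inter (e'.isOpen_inter_preimage Metric.isOpen_ball)
  have hps : p ∈ e'.source := mem_chart_source ℂ p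
  refine ⟨e'.restr s, restr_mem_maximalAtlas _ he' hs, ?_, ?_, ?_⟩
  · rw [OpenPartialHomeomorph.restr_source' _ _ hs]
    refine ⟨hps, hp, hps, ?_⟩
    rw [mem_preimage, hb]
    simp
  · rw [OpenPartialHomeomorph.restr_source' _ _ hs]
    exact fun x hx => hx.2.1
  · intro y hy
    have h1 := (e'.restr s).map_target hy
    rw [OpenPartialHomeomorph.restr_source' _ _ hs] at h1
    have h2 := h1.2.2.2
    have h3 := (e'.restr s).right_inv hy
    rw [← h3]
    exact h2

/-- Any two points lie in the domain of a common (possibly disconnected) holomorphic chart. -/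
theorem exists_chart_of_pair [T2Space C] (p q : C) :
    ∃ f ∈ IsManifold.maximalAtlas 𝓘(ℂ) ω C, p ∈ f.source ∧ q ∈ f.source := by
  classical
  by_cases hpq : p = q
  · subst hpq
    exact ⟨chartAt ℂ p, IsManifold.chart_mem_maximalAtlas p, mem_chart_source ℂ p,
      mem_chart_source ℂ p⟩
  obtain ⟨A, B, hA, hB, hpA, hqB, hAB⟩ := t2_separation hpq
  obtain ⟨φ, hφ, hpφ, hφA, hφt⟩ := exists_small_chart p hA hpA 0
  obtain ⟨ψ, hψ, hqψ, hψB, hψt⟩ := exists_small_chart q hB hqB 3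
  have hs : Disjoint φ.source ψ.source := hAB.mono hφA hψB
  have ht : Disjoint φ.target ψ.target := by
    refine Disjoint.mono hφt hψt (Metric.ball_disjoint_ball ?_)
    norm_num [dist_eq_norm]
  refine ⟨φ.disjointUnion ψ hs ht, ?_, Or.inl hpφ, Or.inr hqψ⟩
  refine OpenPartialHomeomorph.mem_maximalAtlas_of_contMDiffOn _ ?_ ?_
  · refine ContMDiffOn.union_of_isOpen ?_ ?_ φ.open_source ψ.open_source
    · refine (contMDiffOn_of_mem_maximalAtlas hφ).congr fun x hx => ?_
      exact Set.piecewise_eq_of_mem _ _ _ hx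
    · refine (contMDiffOn_of_mem_maximalAtlas hψ).congr fun x hx => ?_
      exact Set.piecewise_eq_of_notMem _ _ _ (fun h => hs.le_bot ⟨h, hx⟩)
  · refine ContMDiffOn.union_of_isOpen ?_ ?_ φ.open_target ψ.open_target
    · refine (contMDiffOn_symm_of_mem_maximalAtlas hφ).congr fun x hx => ?_
      exact Set.piecewise_eq_of_mem _ _ _ hx
    · refine (contMDiffOn_symm_of_mem_maximalAtlas hψ).congr fun x hx => ?_
      exact Set.piecewise_eq_of_notMem _ _ _ (fun h => ht.le_bot ⟨h, hx⟩)

theorem exists_symChart [T2Space C] (D : Sym2 C) :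
    ∃ f ∈ IsManifold.maximalAtlas 𝓘(ℂ) ω C, D ∈ (symChart f).source := by
  induction D with | h p q => ?_
  obtain ⟨f, hf, hp, hq⟩ := exists_chart_of_pair p q
  refine ⟨f, hf, ?_⟩
  rw [symChart_source]
  simp [hp, hq]

/-- The symmetric square of a Riemann surface is a complex surface. -/
noncomputable instance [T2Space C] : ChartedSpace (ℂ × ℂ) (Sym2 C) where
  atlas := symChart '' IsManifold.maximalAtlas 𝓘(ℂ) ω C
  chartAt D := symChart (exists_symChart D).choose
  mem_chart_source D := (exists_symChart D).choose_spec.2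
  chart_mem_atlas D := ⟨_, (exists_symChart D).choose_spec.1, rfl⟩

instance [T2Space C] : IsManifold 𝓘(ℂ, ℂ × ℂ) ω (Sym2 C) := by
  refine isManifold_of_contDiffOn _ _ _ ?_
  rintro _ _ ⟨f, hf, rfl⟩ ⟨g, hg, rfl⟩
  simpa using symChart_contDiffOn C f g hf hg

instance [T2Space C] : T2Space (Sym2 C) := by
  have hq : IsOpenQuotientMap (fun x : C × C => s(x.1, x.2)) :=
    ⟨(isQuotientMap_mk C).surjective, continuous_mk C, isOpenMap_mk C⟩
  rw [t2Space_iff_of_isOpenQuotientMap hq]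
  have : {q : (C × C) × C × C | s(q.1.1, q.1.2) = s(q.2.1, q.2.2)}
      = {q | q.1 = q.2} ∪ {q | q.1 = q.2.swap} := by
    ext ⟨⟨a, b⟩, c, d⟩
    simp [Sym2.eq]
  rw [this]
  exact (isClosed_eq continuous_fst continuous_snd).union
    (isClosed_eq continuous_fst (continuous_swap.comp continuous_snd))

end Manifold
end SymSq

/-! ### Holomorphic forms on complex manifolds -/

section Forms

variable {E : Type*} [NormedAddCommGroup E] [NormedSpace ℂ E]
  {H : Type*} [TopologicalSpace H] (I : ModelWithCorners ℂ E H)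
  (M : Type*) [TopologicalSpace M] [ChartedSpace H M]

/-- Sections of the holomorphic cotangent bundle of a complex manifold, without any regularity. -/
abbrev OneForm : Type _ := (x : M) → TangentSpace I x →L[ℂ] ℂ

/-- Sections of the second exterior power of the holomorphic cotangent bundle, without any
regularity. -/
abbrev TwoForm : Type _ := (x : M) → TangentSpace I x [⋀^Fin 2]→L[ℂ] ℂ

variable {I M}

/-- The wedge product `(α ∧ β)(u, v) = α(u) β(v) - α(v) β(u)`. -/
noncomputable def OneForm.wedge (α β : OneForm I M) : TwoForm I M := fun x =>
  { toFun := fun v => α x (v 0) * β x (v 1) - α x (v 1) * β x (v 0)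
    map_update_add' := by
      intro _ v i u w
      fin_cases i <;> simp [Function.update] <;> ring
    map_update_smul' := by
      intro _ v i c u
      fin_cases i <;> simp [Function.update] <;> ring
    map_eq_zero_of_eq' := by
      intro v i j hv hij
      have h : v 0 = v 1 := by fin_cases i <;> fin_cases j <;> simp_all
      simp only [h, sub_self]
    cont := by
      have h0 : Continuous fun v : Fin 2 → TangentSpace I x => v 0 := continuous_apply 0
      have h1 : Continuous fun v : Fin 2 → TangentSpace I x => v 1 := continuous_apply 1
      exact (((α x).continuous.comp h0).mul ((β x).continuous.comp h1)).sub
        (((α x).continuous.comp h1).mul ((β x).continuous.comp h0)) }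

theorem OneForm.wedge_apply (α β : OneForm I M) (x : M) (v : Fin 2 → TangentSpace I x) :
    OneForm.wedge α β x v = α x (v 0) * β x (v 1) - α x (v 1) * β x (v 0) := rfl

variable {E' : Type*} [NormedAddCommGroup E'] [NormedSpace ℂ E']
  {H' : Type*} [TopologicalSpace H'] {J : ModelWithCorners ℂ E' H'}
  {N : Type*} [TopologicalSpace N] [ChartedSpace H' N]

variable (I J) in
/-- The pullback `f^* β` of a `1`-form. -/
noncomputable def OneForm.pullback (f : M → N) (β : OneForm J N) : OneForm I M :=
  fun x => (β (f x)).comp (mfderiv I J f x)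

end Forms

section Holomorphic

variable (E : Type*) [NormedAddCommGroup E] [NormedSpace ℂ E]
  (M : Type*) [TopologicalSpace M] [ChartedSpace E M]

/-- The space `H^{1,0}(M)` of holomorphic `1`-forms on a finite-dimensional complex manifold: in each chart, that is, after pulling back
along the inverse of the chart, the coefficients are holomorphic functions. -/
def HolOneForm : Submodule ℂ (OneForm 𝓘(ℂ, E) M) where
  carrier := {α | ∀ (x₀ : M) (v : E), DifferentiableOn ℂ
    (fun y : E => α ((chartAt E x₀).symm y)
      (mfderiv 𝓘(ℂ, E) 𝓘(ℂ, E) (chartAt E x₀).symm y v)) (chartAt E x₀).target}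
  add_mem' := fun hα hβ x₀ v => (hα x₀ v).add (hβ x₀ v)
  zero_mem' := fun _ _ => differentiableOn_const 0
  smul_mem' := fun c _ hα x₀ v => (hα x₀ v).const_smul c

/-- The space `H^{2,0}(M)` of holomorphic `2`-forms. -/
def HolTwoForm : Submodule ℂ (TwoForm 𝓘(ℂ, E) M) where
  carrier := {θ | ∀ (x₀ : M) (v : Fin 2 → E), DifferentiableOn ℂ
    (fun y : E => θ ((chartAt E x₀).symm y)
      (fun i => mfderiv 𝓘(ℂ, E) 𝓘(ℂ, E) (chartAt E x₀).symm y (v i))) (chartAt E x₀).target}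
  add_mem' := fun hα hβ x₀ v => (hα x₀ v).add (hβ x₀ v)
  zero_mem' := fun _ _ => differentiableOn_const 0
  smul_mem' := fun c _ hα x₀ v => (hα x₀ v).const_smul c

variable {E M}

/-- The wedge product of two holomorphic `1`-forms, as a holomorphic `2`-form. -/
noncomputable def HolOneForm.wedge (α β : HolOneForm E M) : HolTwoForm E M :=
  ⟨OneForm.wedge α.1 β.1, fun x₀ v =>
    ((α.2 x₀ (v 0)).mul (β.2 x₀ (v 1))).sub ((α.2 x₀ (v 1)).mul (β.2 x₀ (v 0)))⟩

/-- For a space `W` of holomorphic `1`-forms, the space `W² ⊆ H^{2,0}(M)` (the image of `⋀² W`)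
spanned by the wedge products of elements of `W`. -/
noncomputable def wedgeSquare (W : Submodule ℂ (HolOneForm E M)) : Submodule ℂ (HolTwoForm E M) :=
  Submodule.span ℂ {θ | ∃ α ∈ W, ∃ β ∈ W, θ = HolOneForm.wedge α β}

/-- The base points of a space of holomorphic `1`-forms: the common zeros. -/
def basePoints (V : Submodule ℂ (HolOneForm E M)) : Set M := {x | ∀ α ∈ V, α.1 x = 0}

/-- The base locus of a linear system of holomorphic `2`-forms: the common zeros. -/
def baseLocus (S : Submodule ℂ (HolTwoForm E M)) : Set M := {x | ∀ θ ∈ S, θ.1 x = 0}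

end Holomorphic

section Curve

variable {C : Type*} [TopologicalSpace C] [ChartedSpace ℂ C] [IsManifold 𝓘(ℂ) ω C]

/-- The `1`-form `Ω` on `C₂` corresponds to the `1`-form `α` on `C` if the pullback of `Ω` under
the quotient map `C × C → C₂` is the invariant form `pr₁^* α + pr₂^* α`. -/
def Corresponds [T2Space C] (Ω : HolOneForm (ℂ × ℂ) (Sym2 C)) (α : HolOneForm ℂ C) : Prop :=
  OneForm.pullback (𝓘(ℂ).prod 𝓘(ℂ)) 𝓘(ℂ, ℂ × ℂ) (fun x : C × C => s(x.1, x.2)) Ω.1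
    = OneForm.pullback (𝓘(ℂ).prod 𝓘(ℂ)) 𝓘(ℂ) (Prod.fst : C × C → C) α.1
      + OneForm.pullback (𝓘(ℂ).prod 𝓘(ℂ)) 𝓘(ℂ) (Prod.snd : C × C → C) α.1

/-- The space `W` of holomorphic `1`-forms on `C₂` that corresponds to the space `V` of holomorphic
`1`-forms on `C` under the isomorphism `H^{1,0}(C₂) ≅ H^{1,0}(C)`. -/
def symForms [T2Space C] (V : Submodule ℂ (HolOneForm ℂ C)) :
    Submodule ℂ (HolOneForm (ℂ × ℂ) (Sym2 C)) where
  carrier := {Ω | ∃ α ∈ V, Corresponds Ω α}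
  add_mem' := by
    rintro Ω Ω' ⟨α, hα, h⟩ ⟨β, hβ, h'⟩
    refine ⟨α + β, V.add_mem hα hβ, ?_⟩
    funext x
    ext v
    have e := congrArg (fun L => L v) (congrFun h x)
    have e' := congrArg (fun L => L v) (congrFun h' x)
    simp only [OneForm.pullback, Pi.add_apply, _root_.add_apply,
      ContinuousLinearMap.comp_apply, Submodule.coe_add] at e e' ⊢
    rw [e, e']
    ring
  zero_mem' := by
    refine ⟨0, V.zero_mem, ?_⟩
    funext x
    ext v
    exact (add_zero (0 : ℂ)).symm
  smul_mem' := by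
    rintro c Ω ⟨α, hα, h⟩
    refine ⟨c • α, V.smul_mem c hα, ?_⟩
    funext x
    ext v
    have e := congrArg (fun L => L v) (congrFun h x)
    simp only [OneForm.pullback, Pi.add_apply, Pi.smul_apply, _root_.add_apply,
      ContinuousLinearMap.comp_apply, Submodule.coe_smul, _root_.smul_apply] at e ⊢
    rw [e, smul_add]

/-- Evaluation at `p` of the forms in `V`, as a linear form on `V`. Here the cotangent line at `p`
is identified with `ℂ` by means of the preferred chart at `p`; another identification would
multiply the linear form by a nonzero constant. -/
noncomputable def evalAt (V : Submodule ℂ (HolOneForm ℂ C)) (p : C) : Module.Dual ℂ V where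
  toFun := fun α => α.1.1 p (show TangentSpace 𝓘(ℂ) p from (1 : ℂ))
  map_add' := fun _ _ => rfl
  map_smul' := fun _ _ => rfl

theorem evalAt_ne_zero {V : Submodule ℂ (HolOneForm ℂ C)} {p : C} (hp : p ∉ basePoints V) :
    evalAt V p ≠ 0 := by
  intro h
  refine hp fun α hα => ?_
  have h1 : α.1 p (show TangentSpace 𝓘(ℂ) p from (1 : ℂ)) = 0 :=
    congrArg (fun L : Module.Dual ℂ V => L ⟨α, hα⟩) h
  exact ContinuousLinearMap.ext_ring (R₁ := ℂ) (M₁ := ℂ) h1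

/-- The map `φ_V : C → ℙ(V^*)` of a base-point-free space `V` of holomorphic forms, that is,
`p ↦ [α₁(p) : α₂(p) : …]` in the coordinates given by a basis `α₁, α₂, …` of `V`. -/
noncomputable def formMap (V : Submodule ℂ (HolOneForm ℂ C)) (hV : basePoints V = ∅) (p : C) :
    Projectivization ℂ (Module.Dual ℂ V) :=
  Projectivization.mk ℂ (evalAt V p) (evalAt_ne_zero (by simp [hV]))

/-- A holomorphic map from a compact Riemann surface to a projective space is birational onto its
image (an isomorphism between the complements of finite sets) if and only if it is injective outside
a finite set. -/
def IsBirationalOntoImage {P : Type*} (φ : C → P) : Prop :=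
  ∃ S : Set C, S.Finite ∧ Set.InjOn φ Sᶜ

/-- The affine coordinate `ℓ ↦ ℓ(α) / ℓ(α₀)` on the open subset `ℓ(α₀) ≠ 0` of `ℙ(V^*)`. -/
noncomputable def affineCoord {V : Type*} [AddCommMonoid V] [Module ℂ V] (α₀ α : V)
    (ℓ : Projectivization ℂ (Module.Dual ℂ V)) : ℂ :=
  ℓ.rep α / ℓ.rep α₀

/-- The differential of `φ_V` vanishes at `p`: the affine coordinates of `φ_V`, on every standard
affine open subset that contains `φ_V(p)`, have derivative zero at `p`. -/
def DifferentialVanishesAt (V : Submodule ℂ (HolOneForm ℂ C)) (hV : basePoints V = ∅) (p : C) :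
    Prop :=
  ∀ α₀ α : V, evalAt V p α₀ ≠ 0 →
    mfderiv 𝓘(ℂ) 𝓘(ℂ) (fun x => affineCoord α₀ α (formMap V hV x)) p = 0

end Curve

/-! ### Holomorphic forms on the curve: coefficients in a chart and local primitives. -/

section CurveForms

variable {C : Type*} [TopologicalSpace C] [ChartedSpace ℂ C]

/-! The base locus is read off in the coordinates (s, t) = (z + w, zw) of the symmetric square. Take
a chart around p and q, write α = a dz, and let Ω = A ds + B dt correspond to α. Restricting Ω to
the curve z ↦ {z, w} with w fixed gives A + wB = a(z); exchanging z and w gives A + zB = a(w). Hence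
(w - z)B = a(z) - a(w) (`symCoeff_snd_mul`), and by continuity B = -a' on the diagonal
(`symCoeff_snd_diag`). For a second pair Ω₁ = A₁ ds + B₁ dt, β = b dz, the coefficient AB₁ - BA₁ of
Ω ∧ Ω₁ is the minor a(z)b(w) - b(z)a(w) divided by z - w off the diagonal, and minus the Wronskian
of a and b on it.

Every α in V does occur: if h is a local primitive of α, the differentials of {x, y} ↦ h x + h y
glue to a holomorphic form corresponding to α (`corresponds_symOneForm`). So p + q with p ≠ q is a
base point exactly when all minors vanish, that is, φ_V(p) = φ_V(q); and 2p is one exactly when all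
Wronskians vanish, that is, the differential of φ_V vanishes at p. If p is a base point of V, both
criteria hold trivially, which gives the first claim.

For finiteness, an infinite fibre or an infinite set of cusps would accumulate by compactness. The
identity theorem would then make φ_V constant near the accumulation point, contradicting injectivity
outside a finite set. A node has one of its two points in that finite set, so finite fibres leave
finitely many nodes. -/

/-- A chart in the maximal atlas of a complex manifold is biholomorphic. -/
theorem mdifferentiable_of_mem_maximalAtlas {E : Type*} [NormedAddCommGroup E] [NormedSpace ℂ E]
    {M : Type*} [TopologicalSpace M] [ChartedSpace E M] {f : OpenPartialHomeomorph M E}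
    (hf : f ∈ IsManifold.maximalAtlas 𝓘(ℂ, E) ω M) :
    f.MDifferentiable 𝓘(ℂ, E) 𝓘(ℂ, E) :=
  ⟨(contMDiffOn_of_mem_maximalAtlas hf).mdifferentiableOn (by simp),
    (contMDiffOn_symm_of_mem_maximalAtlas hf).mdifferentiableOn (by simp)⟩

/-- The coefficient `a` of a form `α = a dz` in a chart. -/
noncomputable def formCoeff (f : OpenPartialHomeomorph C ℂ) (α : OneForm 𝓘(ℂ) C) (z : ℂ) : ℂ :=
  α (f.symm z) (mfderiv 𝓘(ℂ) 𝓘(ℂ) f.symm z (1 : ℂ))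

/-- The differential of a chart of a curve, as a linear form on the tangent line. -/
noncomputable def chartDeriv (f : OpenPartialHomeomorph C ℂ) (x : C) :
    TangentSpace 𝓘(ℂ) x →L[ℂ] ℂ :=
  mfderiv 𝓘(ℂ) 𝓘(ℂ) f x

/-- The differentials of `f` and `f.symm` are mutually inverse, and the tangent spaces are lines.
This formula turns statements about forms into statements about functions of one variable. -/
theorem apply_eq_formCoeff_mul {f : OpenPartialHomeomorph C ℂ}
    (hf : f ∈ IsManifold.maximalAtlas 𝓘(ℂ) ω C) (α : OneForm 𝓘(ℂ) C) {x : C} (hx : x ∈ f.source)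
    (v : TangentSpace 𝓘(ℂ) x) : α x v = formCoeff f α (f x) * chartDeriv f x v := by
  have h := (mdifferentiable_of_mem_maximalAtlas hf).symm_comp_deriv hx
  -- The point `f.symm (f x)` equals `x` only propositionally, so the change of base point is made
  -- for a variable `y`.
  have h1 : ∀ y (hy : y = x) , α x v = α y (mfderiv 𝓘(ℂ) 𝓘(ℂ) f.symm (f x) (chartDeriv f x v)) := by
    rintro y rfl
    exact congrArg (α y) (congrArg (fun L => L v) h).symm
  rw [h1 _ (f.left_inv hx)]
  have h2 : (chartDeriv f x v : ℂ) = chartDeriv f x v • (1 : ℂ) := by simp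
  rw [formCoeff, mul_comm, ← smul_eq_mul, ← map_smul]
  congr 1
  refine Eq.trans ?_ ((mfderiv 𝓘(ℂ) 𝓘(ℂ) f.symm (f x)).map_smul (chartDeriv f x v) (1 : ℂ))
  congr 1

theorem chartDeriv_one_ne_zero {f : OpenPartialHomeomorph C ℂ}
    (hf : f ∈ IsManifold.maximalAtlas 𝓘(ℂ) ω C) {x : C} (hx : x ∈ f.source) :
    chartDeriv f x (1 : ℂ) ≠ 0 := fun h =>
  one_ne_zero (α := ℂ) ((mdifferentiable_of_mem_maximalAtlas hf).mfderiv_injective hx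
    (h.trans (map_zero (chartDeriv f x)).symm))

theorem form_eq_zero_iff {f : OpenPartialHomeomorph C ℂ}
    (hf : f ∈ IsManifold.maximalAtlas 𝓘(ℂ) ω C) (α : OneForm 𝓘(ℂ) C) {x : C} (hx : x ∈ f.source) :
    α x = 0 ↔ formCoeff f α (f x) = 0 := by
  constructor
  · intro h
    have := apply_eq_formCoeff_mul hf α hx (1 : ℂ)
    rw [h] at this
    exact (mul_eq_zero.1 this.symm).resolve_right (chartDeriv_one_ne_zero hf hx)
  · intro h
    refine ContinuousLinearMap.ext fun v => ?_
    rw [apply_eq_formCoeff_mul hf α hx v, h, zero_mul]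
    rfl

variable [IsManifold 𝓘(ℂ) ω C]

/-- Holomorphy of a form is defined through preferred charts only. In any other chart the
coefficient is multiplied by the derivative of the coordinate change `k`, which is again
holomorphic. -/
theorem differentiableOn_formCoeff {f : OpenPartialHomeomorph C ℂ}
    (hf : f ∈ IsManifold.maximalAtlas 𝓘(ℂ) ω C) (α : HolOneForm ℂ C) :
    DifferentiableOn ℂ (formCoeff f α.1) f.target := by
  intro z₀ hz₀
  have hfd := mdifferentiable_of_mem_maximalAtlas hf
  let e := chartAt ℂ (f.symm z₀)
  have he : e ∈ IsManifold.maximalAtlas 𝓘(ℂ) ω C := IsManifold.chart_mem_maximalAtlas _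
  have hed := mdifferentiable_of_mem_maximalAtlas he
  have hs0 : z₀ ∈ (f.symm.trans e).source := ⟨hz₀, mem_chart_source ℂ _⟩
  have hs := (f.symm.trans e).open_source.mem_nhds hs0
  let k : ℂ → ℂ := e ∘ f.symm
  have hkd : DifferentiableOn ℂ k (f.symm.trans e).source :=
    (hfd.symm.trans hed).1.differentiableOn
  have hkd' : DifferentiableAt ℂ (deriv k) z₀ :=
    ((hkd.deriv (f.symm.trans e).open_source) z₀ hs0).differentiableAt hs
  have hae : DifferentiableOn ℂ (formCoeff e α.1) e.target := α.2 (f.symm z₀) 1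
  have hk0 : k z₀ ∈ e.target := e.map_source (mem_chart_source ℂ _)
  have h1 : DifferentiableAt ℂ (fun z => formCoeff e α.1 (k z)) z₀ :=
    (hae.differentiableAt (e.open_target.mem_nhds hk0)).comp z₀ (hkd.differentiableAt hs)
  refine ((h1.mul hkd').congr_of_eventuallyEq ?_).differentiableWithinAt
  filter_upwards [hs] with z hz
  refine (apply_eq_formCoeff_mul he α.1 (x := f.symm z) hz.2 _).trans ?_
  refine congrArg (formCoeff e α.1 (k z) * ·) ?_
  have h2 : mfderiv 𝓘(ℂ) 𝓘(ℂ) k z = (mfderiv 𝓘(ℂ) 𝓘(ℂ) e (f.symm z)).comp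
      (mfderiv 𝓘(ℂ) 𝓘(ℂ) f.symm z) :=
    mfderiv_comp z (hed.mdifferentiableAt hz.2) (hfd.mdifferentiableAt_symm hz.1)
  rw [mfderiv_eq_fderiv] at h2
  exact (congrArg (fun L => L (1 : ℂ)) h2).symm

/-- Near `p`, the form `α` is the differential of the function `h`. -/
def IsPrimitiveAt (h : C → ℂ) (α : OneForm 𝓘(ℂ) C) (p : C) : Prop :=
  ∀ᶠ x in 𝓝 p, HasMFDerivAt 𝓘(ℂ) 𝓘(ℂ) h x (α x)

/-- A holomorphic function on a disc has a primitive. -/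
theorem exists_isPrimitiveAt (α : HolOneForm ℂ C) (p : C) :
    ∃ h : C → ℂ, IsPrimitiveAt h α.1 p := by
  let e := chartAt ℂ p
  have he : e ∈ IsManifold.maximalAtlas 𝓘(ℂ) ω C := IsManifold.chart_mem_maximalAtlas _
  have hp : p ∈ e.source := mem_chart_source ℂ p
  obtain ⟨r, hr, hball⟩ := Metric.isOpen_iff.1 e.open_target (e p) (e.map_source hp)
  obtain ⟨H, hH⟩ := ((differentiableOn_formCoeff he α).mono hball).isExactOn_ball
  refine ⟨H ∘ e, ?_⟩
  filter_upwards [e.open_source.mem_nhds hp,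
    (e.continuousAt hp).preimage_mem_nhds (Metric.ball_mem_nhds _ hr)] with x hx hxb
  have h1 : HasMFDerivAt 𝓘(ℂ) 𝓘(ℂ) H (e x)
      (ContinuousLinearMap.toSpanSingleton ℂ (formCoeff e α.1 (e x))) :=
    (hH _ hxb).hasFDerivAt.hasMFDerivAt
  have h2 := ((mdifferentiable_of_mem_maximalAtlas he).mdifferentiableAt hx).hasMFDerivAt
  refine (h1.comp x h2).congr_mfderiv ?_
  refine ContinuousLinearMap.ext fun v => ?_
  exact (mul_comm _ _).trans (apply_eq_formCoeff_mul he α.1 hx v).symm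

/-- Primitives at two distinct points are glued along disjoint neighbourhoods; a single function `h`
is needed to define a function on unordered pairs. -/
theorem exists_isPrimitiveAt_pair [T2Space C] (α : HolOneForm ℂ C) (p q : C) :
    ∃ h : C → ℂ, IsPrimitiveAt h α.1 p ∧ IsPrimitiveAt h α.1 q := by
  classical
  obtain ⟨h, hh⟩ := exists_isPrimitiveAt α p
  by_cases hpq : p = q
  · exact ⟨h, hh, hpq ▸ hh⟩
  obtain ⟨k, hk⟩ := exists_isPrimitiveAt α q
  obtain ⟨A, B, hA, hB, hpA, hqB, hAB⟩ := t2_separation hpq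
  refine ⟨A.piecewise h k, ?_, ?_⟩
  · filter_upwards [hh, hA.mem_nhds hpA] with x hx hxA
    refine hx.congr_of_eventuallyEq ?_
    filter_upwards [hA.mem_nhds hxA] with y hy using Set.piecewise_eq_of_mem _ _ _ hy
  · filter_upwards [hk, hB.mem_nhds hqB] with x hx hxB
    refine hx.congr_of_eventuallyEq ?_
    filter_upwards [hB.mem_nhds hxB] with y hy
    exact Set.piecewise_eq_of_notMem _ _ _ fun h => hAB.le_bot ⟨h, hy⟩

omit [IsManifold 𝓘(ℂ) ω C] in
theorem IsPrimitiveAt.analyticAt {h : C → ℂ} {α : OneForm 𝓘(ℂ) C} {f : OpenPartialHomeomorph C ℂ}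
    (hf : f ∈ IsManifold.maximalAtlas 𝓘(ℂ) ω C) {x : C} (hx : x ∈ f.source)
    (hh : IsPrimitiveAt h α x) : AnalyticAt ℂ (h ∘ f.symm) (f x) := by
  rw [Complex.analyticAt_iff_eventually_differentiableAt]
  have hc : Filter.Tendsto f.symm (𝓝 (f x)) (𝓝 x) := by
    have := f.continuousAt_symm (f.map_source hx)
    rwa [ContinuousAt, f.left_inv hx] at this
  filter_upwards [hc.eventually hh, f.open_target.mem_nhds (f.map_source hx)] with z hz hzt
  rw [← mdifferentiableAt_iff_differentiableAt]
  exact hz.mdifferentiableAt.comp z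
    ((mdifferentiable_of_mem_maximalAtlas hf).mdifferentiableAt_symm hzt)

end CurveForms

/-! ### The form on the symmetric square that corresponds to a form on the curve. -/

section SymmetricForms

variable {C : Type*} [TopologicalSpace C] [ChartedSpace ℂ C]

theorem IsPrimitiveAt.eventually_hasDerivAt {h : C → ℂ} {α : OneForm 𝓘(ℂ) C}
    {f : OpenPartialHomeomorph C ℂ} (hf : f ∈ IsManifold.maximalAtlas 𝓘(ℂ) ω C) {x : C}
    (hx : x ∈ f.source) (hh : IsPrimitiveAt h α x) :
    ∀ᶠ z in 𝓝 (f x), HasDerivAt (h ∘ f.symm) (formCoeff f α z) z := by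
  have hc : Filter.Tendsto f.symm (𝓝 (f x)) (𝓝 x) := by
    have := f.continuousAt_symm (f.map_source hx)
    rwa [ContinuousAt, f.left_inv hx] at this
  filter_upwards [hc.eventually hh, f.open_target.mem_nhds (f.map_source hx)] with z hz hzt
  have h1 := hz.comp z
    ((mdifferentiable_of_mem_maximalAtlas hf).mdifferentiableAt_symm hzt).hasMFDerivAt
  let L : ℂ →L[ℂ] ℂ := (α (f.symm z)).comp (mfderiv 𝓘(ℂ) 𝓘(ℂ) f.symm z)
  have h2 : HasFDerivAt (h ∘ f.symm) L z := hasMFDerivAt_iff_hasFDerivAt.1 h1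
  exact h2.hasDerivAt

/-- In a disc of the chart the difference of the two primitives has zero derivative. -/
theorem IsPrimitiveAt.exists_eventually_eq_add {h k : C → ℂ} {α : OneForm 𝓘(ℂ) C}
    {f : OpenPartialHomeomorph C ℂ} (hf : f ∈ IsManifold.maximalAtlas 𝓘(ℂ) ω C) {x : C}
    (hx : x ∈ f.source) (hh : IsPrimitiveAt h α x) (hk : IsPrimitiveAt k α x) :
    ∃ c : ℂ, ∀ᶠ y in 𝓝 x, h y = k y + c := by
  obtain ⟨r, hr, hball⟩ := Metric.eventually_nhds_iff_ball.1
    ((hh.eventually_hasDerivAt hf hx).and (hk.eventually_hasDerivAt hf hx))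
  obtain ⟨c, hc⟩ := Metric.isOpen_ball.exists_is_const_of_deriv_eq_zero
    (f := fun z => (h ∘ f.symm) z - (k ∘ f.symm) z)
    (convex_ball (f x) r).isPreconnected
    (fun z hz => ((hball z hz).1.sub (hball z hz).2).differentiableAt.differentiableWithinAt)
    (fun z hz => ((hball z hz).1.sub (hball z hz).2).deriv.trans (sub_self _))
  refine ⟨c, ?_⟩
  filter_upwards [f.open_source.mem_nhds hx,
    (f.continuousAt hx).preimage_mem_nhds (Metric.ball_mem_nhds _ hr)] with y hy hyb
  have := hc _ hyb
  simp only [Function.comp_apply, f.left_inv hy] at this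
  rw [← this]
  ring

/-- The function `{x, y} ↦ h x + h y` on the symmetric square. -/
def symFun (h : C → ℂ) : Sym2 C → ℂ :=
  Sym2.lift ⟨fun x y => h x + h y, fun _ _ => add_comm _ _⟩

variable [IsManifold 𝓘(ℂ) ω C]

-- In coordinates the function is H(z) + H(w) with H holomorphic, hence analytic in z + w and zw,
-- also at points of the diagonal.
omit [IsManifold 𝓘(ℂ) ω C] in
theorem analyticAt_symFun {h : C → ℂ} {α : OneForm 𝓘(ℂ) C}
    {f : OpenPartialHomeomorph C ℂ} (hf : f ∈ IsManifold.maximalAtlas 𝓘(ℂ) ω C) {D : Sym2 C}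
    (hD : D ∈ (SymSq.symChart f).source) (hh : ∀ x ∈ D, IsPrimitiveAt h α x) :
    AnalyticAt ℂ (symFun h ∘ (SymSq.symChart f).symm) (SymSq.symChart f D) := by
  induction D with | h p q => ?_
  have hp : p ∈ f.source := hD p (by simp)
  have hq : q ∈ f.source := hD q (by simp)
  rw [SymSq.symChart_mk]
  refine SymSq.analyticAt_symm_sum (h ∘ f.symm) (f p) (f q) ((hh p (by simp)).analyticAt hf hp)
    ((hh q (by simp)).analyticAt hf hq) _ (Filter.Eventually.of_forall fun x => ?_)
  simp only [Function.comp_apply, SymSq.symChart_symm]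
  rfl

variable [T2Space C]

theorem chartAt_sym2 (D : Sym2 C) :
    ∃ f ∈ IsManifold.maximalAtlas 𝓘(ℂ) ω C, chartAt (ℂ × ℂ) D = SymSq.symChart f :=
  ⟨_, (SymSq.exists_symChart D).choose_spec.1, rfl⟩

theorem symChart_mdifferentiable {f : OpenPartialHomeomorph C ℂ}
    (hf : f ∈ IsManifold.maximalAtlas 𝓘(ℂ) ω C) :
    (SymSq.symChart f).MDifferentiable 𝓘(ℂ, ℂ × ℂ) 𝓘(ℂ, ℂ × ℂ) :=
  mdifferentiable_of_mem_maximalAtlas (IsManifold.subset_maximalAtlas ⟨f, hf, rfl⟩)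

theorem mdifferentiableAt_symFun {h : C → ℂ} {α : OneForm 𝓘(ℂ) C} {D : Sym2 C}
    (hh : ∀ x ∈ D, IsPrimitiveAt h α x) :
    MDifferentiableAt 𝓘(ℂ, ℂ × ℂ) 𝓘(ℂ) (symFun h) D := by
  obtain ⟨f, hf, hD⟩ := SymSq.exists_symChart D
  have h1 := (analyticAt_symFun hf hD hh).differentiableAt.mdifferentiableAt
  have h2 := (symChart_mdifferentiable hf).mdifferentiableAt hD
  refine (h1.comp D h2).congr_of_eventuallyEq ?_
  filter_upwards [(SymSq.symChart f).open_source.mem_nhds hD] with D' hD'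
  simp [(SymSq.symChart f).left_inv hD']

omit [IsManifold 𝓘(ℂ) ω C] [T2Space C] in
theorem eventually_isPrimitiveAt {h : C → ℂ} {α : OneForm 𝓘(ℂ) C} {D : Sym2 C}
    (hh : ∀ x ∈ D, IsPrimitiveAt h α x) : ∀ᶠ D' in 𝓝 D, ∀ x ∈ D', IsPrimitiveAt h α x := by
  have ho : IsOpen {x | IsPrimitiveAt h α x} :=
    isOpen_iff_mem_nhds.2 fun x hx => Filter.Eventually.eventually_nhds hx
  exact (SymSq.isOpen_pairs ho).mem_nhds hh

/-- This makes the construction of the corresponding form independent of the primitive. The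
primitives may differ by different constants near the two points, but the symmetrized functions then
differ by the sum of these constants. -/
theorem mfderiv_symFun_eq {h k : C → ℂ} {α : OneForm 𝓘(ℂ) C} {D : Sym2 C}
    (hh : ∀ x ∈ D, IsPrimitiveAt h α x) (hk : ∀ x ∈ D, IsPrimitiveAt k α x) :
    (mfderiv 𝓘(ℂ, ℂ × ℂ) 𝓘(ℂ) (symFun h) D : TangentSpace 𝓘(ℂ, ℂ × ℂ) D →L[ℂ] ℂ) =
      mfderiv 𝓘(ℂ, ℂ × ℂ) 𝓘(ℂ) (symFun k) D := by
  have hkd := mdifferentiableAt_symFun hk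
  induction D with | h p q => ?_
  obtain ⟨c, hc⟩ := (hh p (by simp)).exists_eventually_eq_add (IsManifold.chart_mem_maximalAtlas p)
    (mem_chart_source ℂ p) (hk p (by simp))
  obtain ⟨d, hd⟩ := (hh q (by simp)).exists_eventually_eq_add (IsManifold.chart_mem_maximalAtlas q)
    (mem_chart_source ℂ q) (hk q (by simp))
  have h1 : ∀ᶠ D' in 𝓝 s(p, q), symFun h D' = symFun k D' + (c + d) := by
    have hcd : ∀ᶠ x : C × C in 𝓝 (p, q), h x.1 = k x.1 + c ∧ h x.2 = k x.2 + d := by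
      rw [nhds_prod_eq]
      exact hc.prod_mk hd
    filter_upwards [(SymSq.isOpenMap_mk C).image_mem_nhds hcd]
    rintro _ ⟨x, ⟨h1, h2⟩, rfl⟩
    change h x.1 + h x.2 = k x.1 + k x.2 + (c + d)
    rw [h1, h2]
    ring
  have h2 : HasMFDerivAt 𝓘(ℂ, ℂ × ℂ) 𝓘(ℂ) (fun D' => symFun k D' + (c + d)) s(p, q)
      (mfderiv 𝓘(ℂ, ℂ × ℂ) 𝓘(ℂ) (symFun k) s(p, q)) := by
    have h3 := hkd.hasMFDerivAt.add
      (hasMFDerivAt_const (I := 𝓘(ℂ, ℂ × ℂ)) (I' := 𝓘(ℂ)) (c + d) s(p, q))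
    exact h3.congr_mfderiv (add_zero _)
  exact (h2.congr_of_eventuallyEq h1).mfderiv

/-- The form on the symmetric square that corresponds to the form `α`: near each point it is the
differential of `{x, y} ↦ h x + h y`, where `h` is a local primitive of `α`. -/
noncomputable def symOneForm (α : HolOneForm ℂ C) : OneForm 𝓘(ℂ, ℂ × ℂ) (Sym2 C) := fun D =>
  mfderiv 𝓘(ℂ, ℂ × ℂ) 𝓘(ℂ)
    (symFun (exists_isPrimitiveAt_pair α (Quot.out D).1 (Quot.out D).2).choose) D

theorem symOneForm_eq {α : HolOneForm ℂ C} {h : C → ℂ} {D : Sym2 C}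
    (hh : ∀ x ∈ D, IsPrimitiveAt h α.1 x) :
    symOneForm α D = mfderiv 𝓘(ℂ, ℂ × ℂ) 𝓘(ℂ) (symFun h) D := by
  have hs := (exists_isPrimitiveAt_pair α (Quot.out D).1 (Quot.out D).2).choose_spec
  refine mfderiv_symFun_eq (fun x hx => ?_) hh
  have hD : D = s((Quot.out D).1, (Quot.out D).2) := (Quot.out_eq D).symm
  have hx' : x ∈ s((Quot.out D).1, (Quot.out D).2) := hD ▸ hx
  rcases Sym2.mem_iff.1 hx' with h | h
  · exact h ▸ hs.1
  · exact h ▸ hs.2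

theorem exists_primitive_of_sym2 (α : HolOneForm ℂ C) (D : Sym2 C) :
    ∃ h : C → ℂ, ∀ x ∈ D, IsPrimitiveAt h α.1 x := by
  induction D with | h p q => ?_
  obtain ⟨h, hp, hq⟩ := exists_isPrimitiveAt_pair α p q
  refine ⟨h, fun x hx => ?_⟩
  rcases Sym2.mem_iff.1 hx with rfl | rfl
  · exact hp
  · exact hq

/-- A primitive chosen for one pair also serves all nearby pairs, so the coefficients are locally
partial derivatives of one analytic function. -/
theorem symOneForm_mem (α : HolOneForm ℂ C) :
    symOneForm α ∈ HolOneForm (ℂ × ℂ) (Sym2 C) := by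
  intro D₀ v y₀ hy₀
  obtain ⟨f, hf, hfD⟩ := chartAt_sym2 D₀
  rw [hfD] at hy₀ ⊢
  set φ := SymSq.symChart f
  have hφ := symChart_mdifferentiable hf
  obtain ⟨h, hh⟩ := exists_primitive_of_sym2 α (φ.symm y₀)
  have ha : AnalyticAt ℂ (symFun h ∘ φ.symm) y₀ := by
    have := analyticAt_symFun hf (φ.map_target hy₀) hh
    rwa [φ.right_inv hy₀] at this
  have hd : DifferentiableAt ℂ (fun y => fderiv ℂ (symFun h ∘ φ.symm) y v) y₀ :=
    ha.fderiv.differentiableAt.clm_apply (differentiableAt_const v)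
  refine (hd.congr_of_eventuallyEq ?_).differentiableWithinAt
  filter_upwards [φ.open_target.mem_nhds hy₀,
    (φ.continuousAt_symm hy₀).eventually (eventually_isPrimitiveAt hh)] with y hy hhy
  rw [symOneForm_eq hhy, ← mfderiv_eq_fderiv,
    mfderiv_comp y (mdifferentiableAt_symFun hhy) (hφ.mdifferentiableAt_symm hy)]
  rfl

/-- In the charts the quotient map is the polynomial map (z, w) ↦ (z + w, zw). -/
theorem mdifferentiableAt_mk (x : C × C) :
    MDifferentiableAt (𝓘(ℂ).prod 𝓘(ℂ)) 𝓘(ℂ, ℂ × ℂ) (fun x : C × C => s(x.1, x.2)) x := by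
  obtain ⟨f, hf, hD⟩ := SymSq.exists_symChart s(x.1, x.2)
  have hfd := mdifferentiable_of_mem_maximalAtlas hf
  have h1 : x.1 ∈ f.source := hD _ (by simp)
  have h2 : x.2 ∈ f.source := hD _ (by simp)
  have hg1 : MDifferentiableAt (𝓘(ℂ).prod 𝓘(ℂ)) 𝓘(ℂ) (fun y : C × C => f y.1) x :=
    (hfd.mdifferentiableAt h1).comp x mdifferentiableAt_fst
  have hg2 : MDifferentiableAt (𝓘(ℂ).prod 𝓘(ℂ)) 𝓘(ℂ) (fun y : C × C => f y.2) x :=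
    (hfd.mdifferentiableAt h2).comp x mdifferentiableAt_snd
  have hσ : DifferentiableAt ℂ (fun z : ℂ × ℂ => (z.1 + z.2, z.1 * z.2)) (f x.1, f x.2) := by
    fun_prop
  have hg : MDifferentiableAt (𝓘(ℂ).prod 𝓘(ℂ)) 𝓘(ℂ, ℂ × ℂ)
      (fun y : C × C => (f y.1 + f y.2, f y.1 * f y.2)) x :=
    hσ.mdifferentiableAt.comp x (hg1.prodMk_space hg2)
  have ht : (f x.1 + f x.2, f x.1 * f x.2) ∈ (SymSq.symChart f).target :=
    (SymSq.mem_symChart_target f _ _).2 ⟨f.map_source h1, f.map_source h2⟩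
  refine (((symChart_mdifferentiable hf).mdifferentiableAt_symm ht).comp x hg).congr_of_eventuallyEq
    ?_
  filter_upwards [continuousAt_fst.preimage_mem_nhds (f.open_source.mem_nhds h1),
    continuousAt_snd.preimage_mem_nhds (f.open_source.mem_nhds h2)] with y hy1 hy2
  simp only [Function.comp_apply, SymSq.symChart_symm]
  rw [f.left_inv hy1, f.left_inv hy2]

/-- Both sides are the differential of (x, y) ↦ h x + h y on `C × C`. -/
theorem corresponds_symOneForm (α : HolOneForm ℂ C) :
    Corresponds ⟨symOneForm α, symOneForm_mem α⟩ α := by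
  funext x
  obtain ⟨h, hh⟩ := exists_primitive_of_sym2 α s(x.1, x.2)
  have hp : HasMFDerivAt 𝓘(ℂ) 𝓘(ℂ) h x.1 (α.1 x.1) := (hh x.1 (by simp)).self_of_nhds
  have hq : HasMFDerivAt 𝓘(ℂ) 𝓘(ℂ) h x.2 (α.1 x.2) := (hh x.2 (by simp)).self_of_nhds
  have h1 := (mdifferentiableAt_symFun hh).hasMFDerivAt.comp x (mdifferentiableAt_mk x).hasMFDerivAt
  have h2 := (hp.comp x (mdifferentiableAt_fst
      (I := 𝓘(ℂ)) (I' := 𝓘(ℂ))).hasMFDerivAt).add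
    (hq.comp x (mdifferentiableAt_snd (I := 𝓘(ℂ)) (I' := 𝓘(ℂ))).hasMFDerivAt)
  have h3 := hasMFDerivAt_unique h1 h2
  simp only [OneForm.pullback]
  rw [symOneForm_eq hh]
  exact h3

end SymmetricForms

/-! ### Wedge products in the coordinates z + w and zw. -/

section LocalFormula

variable {C : Type*} [TopologicalSpace C] [ChartedSpace ℂ C] [IsManifold 𝓘(ℂ) ω C] [T2Space C]

/-- A form on the symmetric square in the coordinates of `SymSq.symChart f`. -/
noncomputable def symCoeff (f : OpenPartialHomeomorph C ℂ) (Ω : OneForm 𝓘(ℂ, ℂ × ℂ) (Sym2 C))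
    (y : ℂ × ℂ) : ℂ × ℂ →L[ℂ] ℂ :=
  (Ω ((SymSq.symChart f).symm y)).comp
    (mfderiv 𝓘(ℂ, ℂ × ℂ) 𝓘(ℂ, ℂ × ℂ) (SymSq.symChart f).symm y)

/-- The vector (1, w) is the velocity of t ↦ (t + w, tw), the image of the slice of `C × C` on which
the second point is fixed. On this slice pr₂^* α vanishes and pr₁^* α restricts to α. -/
theorem symCoeff_mk {f : OpenPartialHomeomorph C ℂ} (hf : f ∈ IsManifold.maximalAtlas 𝓘(ℂ) ω C)
    {Ω : HolOneForm (ℂ × ℂ) (Sym2 C)} {α : HolOneForm ℂ C} (h : Corresponds Ω α) {z w : ℂ}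
    (hz : z ∈ f.target) (hw : w ∈ f.target) :
    symCoeff f Ω.1 (z + w, z * w) (1, w) = formCoeff f α.1 z := by
  let g : ℂ → C × C := fun t => (f.symm t, f.symm w)
  let τ : ℂ → ℂ × ℂ := fun t => (t + w, t * w)
  have hfd := mdifferentiable_of_mem_maximalAtlas hf
  have hg : HasMFDerivAt 𝓘(ℂ) (𝓘(ℂ).prod 𝓘(ℂ)) g z _ :=
    (hfd.mdifferentiableAt_symm hz).hasMFDerivAt.prodMk
      (hasMFDerivAt_const (I := 𝓘(ℂ)) (I' := 𝓘(ℂ)) (f.symm w) z)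
  have hτ : HasFDerivAt τ (ContinuousLinearMap.toSpanSingleton ℂ ((1, w) : ℂ × ℂ)) z := by
    have h1 : HasDerivAt (fun t : ℂ => t + w) 1 z := (hasDerivAt_id z).add_const w
    have h2 : HasDerivAt (fun t : ℂ => t * w) w z := by
      simpa using (hasDerivAt_id z).mul_const w
    exact (h1.prodMk h2).hasFDerivAt
  have h1 := (mdifferentiableAt_mk (g z)).hasMFDerivAt.comp z hg
  have hy : τ z ∈ (SymSq.symChart f).target := (SymSq.mem_symChart_target f _ _).2 ⟨hz, hw⟩
  have h2 := ((symChart_mdifferentiable hf).mdifferentiableAt_symm hy).hasMFDerivAt.comp z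
    hτ.hasMFDerivAt
  have he : (SymSq.symChart f).symm ∘ τ = (fun x : C × C => s(x.1, x.2)) ∘ g := by
    funext t
    exact SymSq.symChart_symm f t w
  rw [he] at h2
  have h3 := congrArg (fun L => L (1 : ℂ)) (hasMFDerivAt_unique h2 h1)
  have h4 := congrArg (fun L => L (mfderiv 𝓘(ℂ) 𝓘(ℂ) f.symm z (1 : ℂ), (0 : ℂ)))
    (congrFun h (g z))
  simp only [OneForm.pullback, Pi.add_apply, mfderiv_fst, mfderiv_snd] at h4
  have hcongr : ∀ D D' : Sym2 C, D = D' → ∀ v : ℂ × ℂ,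
      (show ℂ × ℂ →L[ℂ] ℂ from Ω.1 D) v = (show ℂ × ℂ →L[ℂ] ℂ from Ω.1 D') v := by
    rintro D _ rfl v
    rfl
  have h5 : (mfderiv 𝓘(ℂ, ℂ × ℂ) 𝓘(ℂ, ℂ × ℂ) (SymSq.symChart f).symm (τ z) : ℂ × ℂ →L[ℂ] ℂ × ℂ)
      (1, w) = (mfderiv (𝓘(ℂ).prod 𝓘(ℂ)) 𝓘(ℂ, ℂ × ℂ)
        (fun x : C × C => s(x.1, x.2)) (g z) : ℂ × ℂ →L[ℂ] ℂ × ℂ)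
          (mfderiv 𝓘(ℂ) 𝓘(ℂ) f.symm z (1 : ℂ), (0 : ℂ)) :=
    (congrArg (mfderiv 𝓘(ℂ, ℂ × ℂ) 𝓘(ℂ, ℂ × ℂ) (SymSq.symChart f).symm (τ z) : ℂ × ℂ →L[ℂ] ℂ × ℂ)
      (one_smul ℂ ((1, w) : ℂ × ℂ)).symm).trans h3
  refine (hcongr _ _ (congrFun he z) _).trans ?_
  refine (congrArg (show ℂ × ℂ →L[ℂ] ℂ from Ω.1 (s((g z).1, (g z).2))) h5).trans ?_
  refine h4.trans ?_
  have h6 : (α.1 (f.symm w)) (0 : ℂ) = 0 := map_zero (α.1 (f.symm w))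
  exact (congrArg (formCoeff f α.1 z + ·) h6).trans (add_zero _)

/-- A 2-form on a plane is determined by its value on a basis, here the images of (1, 0) and (0, 1)
under the differential of the inverse chart. -/
theorem wedge_eq_zero_iff {f : OpenPartialHomeomorph C ℂ}
    (hf : f ∈ IsManifold.maximalAtlas 𝓘(ℂ) ω C) (Ω Ω' : OneForm 𝓘(ℂ, ℂ × ℂ) (Sym2 C))
    {D : Sym2 C} (hD : D ∈ (SymSq.symChart f).source) :
    OneForm.wedge Ω Ω' D = 0 ↔
      symCoeff f Ω (SymSq.symChart f D) (1, 0) * symCoeff f Ω' (SymSq.symChart f D) (0, 1) =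
        symCoeff f Ω (SymSq.symChart f D) (0, 1) * symCoeff f Ω' (SymSq.symChart f D) (1, 0) := by
  obtain ⟨y, hy, rfl⟩ : ∃ y ∈ (SymSq.symChart f).target, (SymSq.symChart f).symm y = D :=
    ⟨_, (SymSq.symChart f).map_source hD, (SymSq.symChart f).left_inv hD⟩
  rw [(SymSq.symChart f).right_inv hy]
  have hsurj : Function.Surjective
      (mfderiv 𝓘(ℂ, ℂ × ℂ) 𝓘(ℂ, ℂ × ℂ) (SymSq.symChart f).symm y) :=
    (symChart_mdifferentiable hf).symm.mfderiv_surjective hy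
  constructor
  · intro h
    have h1 := congrArg (fun L => L ![mfderiv 𝓘(ℂ, ℂ × ℂ) 𝓘(ℂ, ℂ × ℂ) (SymSq.symChart f).symm y
      ((1, 0) : ℂ × ℂ), mfderiv 𝓘(ℂ, ℂ × ℂ) 𝓘(ℂ, ℂ × ℂ) (SymSq.symChart f).symm y
      ((0, 1) : ℂ × ℂ)]) h
    exact sub_eq_zero.1 h1
  · intro h
    refine ContinuousAlternatingMap.ext fun v => ?_
    obtain ⟨u₀, hu₀⟩ := hsurj (v 0)
    obtain ⟨u₁, hu₁⟩ := hsurj (v 1)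
    rw [OneForm.wedge_apply, ← hu₀, ← hu₁]
    have hlin : ∀ (L : ℂ × ℂ →L[ℂ] ℂ) (u : ℂ × ℂ), L u = u.1 * L (1, 0) + u.2 * L (0, 1) := by
      intro L u
      rw [← smul_eq_mul, ← smul_eq_mul, ← map_smul, ← map_smul, ← map_add]
      simp
    change symCoeff f Ω y u₀ * symCoeff f Ω' y u₁ - symCoeff f Ω y u₁ * symCoeff f Ω' y u₀ = 0
    rw [hlin (symCoeff f Ω y) u₀, hlin (symCoeff f Ω y) u₁, hlin (symCoeff f Ω' y) u₀,
      hlin (symCoeff f Ω' y) u₁]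
    linear_combination (u₀.1 * u₁.2 - u₀.2 * u₁.1) * h

/-- The chart has to be a preferred one, because holomorphy of `Ω` is given there. -/
theorem continuousOn_symCoeff {f : OpenPartialHomeomorph C ℂ} {D : Sym2 C}
    (hfD : chartAt (ℂ × ℂ) D = SymSq.symChart f) (Ω : HolOneForm (ℂ × ℂ) (Sym2 C)) (v : ℂ × ℂ) :
    ContinuousOn (fun y => symCoeff f Ω.1 y v) (SymSq.symChart f).target := by
  have := (Ω.2 D v).continuousOn
  rw [hfD] at this
  exact this

/-- The point (z + w, zw) is unchanged when z and w are exchanged, so `symCoeff_mk` gives two linear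
equations for the two coefficients at that point. -/
theorem symCoeff_snd_mul {f : OpenPartialHomeomorph C ℂ}
    (hf : f ∈ IsManifold.maximalAtlas 𝓘(ℂ) ω C)
    {Ω : HolOneForm (ℂ × ℂ) (Sym2 C)} {α : HolOneForm ℂ C} (h : Corresponds Ω α) {z w : ℂ}
    (hz : z ∈ f.target) (hw : w ∈ f.target) :
    symCoeff f Ω.1 (z + w, z * w) (1, 0) + w * symCoeff f Ω.1 (z + w, z * w) (0, 1) =
        formCoeff f α.1 z ∧
      (w - z) * symCoeff f Ω.1 (z + w, z * w) (0, 1) = formCoeff f α.1 z - formCoeff f α.1 w := by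
  have h1 := symCoeff_mk hf h hz hw
  have h2 := symCoeff_mk hf h hw hz
  rw [add_comm w z, mul_comm w z] at h2
  have hlin : ∀ (L : ℂ × ℂ →L[ℂ] ℂ) (u : ℂ), L (1, u) = L (1, 0) + u * L (0, 1) := by
    intro L u
    rw [← smul_eq_mul, ← map_smul, ← map_add]
    simp
  rw [hlin] at h1 h2
  exact ⟨h1, by linear_combination h1 - h2⟩

/-- Off the diagonal this coefficient is minus a difference quotient of the coefficient of α; let w
tend to z and use continuity. -/
theorem symCoeff_snd_diag {f : OpenPartialHomeomorph C ℂ}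
    (hf : f ∈ IsManifold.maximalAtlas 𝓘(ℂ) ω C) {D : Sym2 C}
    (hfD : chartAt (ℂ × ℂ) D = SymSq.symChart f)
    {Ω : HolOneForm (ℂ × ℂ) (Sym2 C)} {α : HolOneForm ℂ C} (h : Corresponds Ω α) {z : ℂ}
    (hz : z ∈ f.target) :
    symCoeff f Ω.1 (z + z, z * z) (0, 1) = -deriv (formCoeff f α.1) z := by
  have ht : f.target ∈ 𝓝 z := f.open_target.mem_nhds hz
  have hy : (z + z, z * z) ∈ (SymSq.symChart f).target :=
    (SymSq.mem_symChart_target f _ _).2 ⟨hz, hz⟩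
  have hd := ((differentiableOn_formCoeff hf α).differentiableAt ht).hasDerivAt
  rw [hasDerivAt_iff_tendsto_slope] at hd
  have hc : ContinuousAt (fun w => symCoeff f Ω.1 (z + w, z * w) (0, 1)) z :=
    ContinuousAt.comp (f := fun w => (z + w, z * w))
      ((continuousOn_symCoeff hfD Ω (0, 1)).continuousAt
        ((SymSq.symChart f).open_target.mem_nhds hy)) (by fun_prop)
  have hc' := (hc.tendsto.mono_left nhdsWithin_le_nhds : Filter.Tendsto _ (𝓝[≠] z) _).neg
  have h2 := tendsto_nhds_unique_of_eventuallyEq hd hc' ?_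
  · rw [h2, neg_neg]
  · filter_upwards [self_mem_nhdsWithin, mem_nhdsWithin_of_mem_nhds ht] with w hw hwt
    have hne : w - z ≠ 0 := sub_ne_zero.2 hw
    have h3 := (symCoeff_snd_mul hf h hz hwt).2
    rw [slope_def_field, div_eq_iff hne]
    linear_combination h3

/-- The `2`-form `Ω ∧ Ω'` vanishes at `p + q`, `p ≠ q`, if and only if the values of the
corresponding forms at `p` and `q` are proportional. -/
theorem wedge_mk_eq_zero_iff {f : OpenPartialHomeomorph C ℂ}
    (hf : f ∈ IsManifold.maximalAtlas 𝓘(ℂ) ω C) {p q : C} (hp : p ∈ f.source) (hq : q ∈ f.source)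
    (hpq : p ≠ q) {Ω Ω' : HolOneForm (ℂ × ℂ) (Sym2 C)} {α β : HolOneForm ℂ C}
    (h : Corresponds Ω α) (h' : Corresponds Ω' β) :
    OneForm.wedge Ω.1 Ω'.1 s(p, q) = 0 ↔
      formCoeff f α.1 (f p) * formCoeff f β.1 (f q) =
        formCoeff f β.1 (f p) * formCoeff f α.1 (f q) := by
  have hD : s(p, q) ∈ (SymSq.symChart f).source := by
    rw [SymSq.symChart_source]
    simp [hp, hq]
  rw [wedge_eq_zero_iff hf _ _ hD, SymSq.symChart_mk]
  obtain ⟨h1, h2⟩ := symCoeff_snd_mul hf h (f.map_source hp) (f.map_source hq)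
  obtain ⟨h1', h2'⟩ := symCoeff_snd_mul hf h' (f.map_source hp) (f.map_source hq)
  have hne : f q - f p ≠ 0 := sub_ne_zero.2 fun e => hpq (f.injOn hp hq e.symm)
  rw [← sub_eq_zero, ← mul_right_inj' hne, mul_zero, ← sub_eq_zero (b := formCoeff f β.1 (f p) * _)]
  set A := symCoeff f Ω.1 (f p + f q, f p * f q) (1, 0)
  set B := symCoeff f Ω.1 (f p + f q, f p * f q) (0, 1)
  set A' := symCoeff f Ω'.1 (f p + f q, f p * f q) (1, 0)
  set B' := symCoeff f Ω'.1 (f p + f q, f p * f q) (0, 1)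
  -- Substitute a(p) = A + f(q)B and a(q) = A + f(p)B, and likewise for β, into the minor.
  have e : (f q - f p) * (A * B' - B * A') = -(formCoeff f α.1 (f p) * formCoeff f β.1 (f q) -
        formCoeff f β.1 (f p) * formCoeff f α.1 (f q)) := by
    have e1 : formCoeff f α.1 (f q) = A + f p * B := by linear_combination h2 - h1
    have e2 : formCoeff f β.1 (f q) = A' + f p * B' := by linear_combination h2' - h1'
    rw [e1, e2, ← h1, ← h1']
    ring
  rw [e, neg_eq_zero]

/-- The `2`-form `Ω ∧ Ω'` vanishes at `2p` if and only if the Wronskian of the corresponding forms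
vanishes at `p`. -/
theorem wedge_diag_eq_zero_iff (p : C) :
    ∃ f ∈ IsManifold.maximalAtlas 𝓘(ℂ) ω C, p ∈ f.source ∧
      ∀ (Ω Ω' : HolOneForm (ℂ × ℂ) (Sym2 C)) (α β : HolOneForm ℂ C),
        Corresponds Ω α → Corresponds Ω' β →
        (OneForm.wedge Ω.1 Ω'.1 s(p, p) = 0 ↔
          formCoeff f α.1 (f p) * deriv (formCoeff f β.1) (f p) =
            formCoeff f β.1 (f p) * deriv (formCoeff f α.1) (f p)) := by
  -- The chart is not arbitrary: the limit defining the diagonal coefficient is taken in the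
  -- preferred chart at 2p.
  obtain ⟨f, hf, hfD⟩ := chartAt_sym2 s(p, p)
  have hD : s(p, p) ∈ (SymSq.symChart f).source := by
    rw [← hfD]
    exact mem_chart_source _ _
  have hp : p ∈ f.source := hD p (by simp)
  refine ⟨f, hf, hp, fun Ω Ω' α β h h' => ?_⟩
  rw [wedge_eq_zero_iff hf _ _ hD, SymSq.symChart_mk]
  have h1 := (symCoeff_snd_mul hf h (f.map_source hp) (f.map_source hp)).1
  have h1' := (symCoeff_snd_mul hf h' (f.map_source hp) (f.map_source hp)).1
  have h2 := symCoeff_snd_diag hf hfD h (f.map_source hp)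
  have h2' := symCoeff_snd_diag hf hfD h' (f.map_source hp)
  rw [← h1, ← h1', ← neg_eq_iff_eq_neg.2 h2, ← neg_eq_iff_eq_neg.2 h2', ← sub_eq_zero,
    ← sub_eq_zero (b := _ * -symCoeff f Ω.1 _ _), ← neg_eq_zero]
  ring_nf

end LocalFormula

/-! ### The map φ_V and its differential in terms of coefficients. -/

section FormMap

variable {C : Type*} [TopologicalSpace C] [ChartedSpace ℂ C] [IsManifold 𝓘(ℂ) ω C]

omit [IsManifold 𝓘(ℂ) ω C] in
theorem evalAt_eq_formCoeff_mul {f : OpenPartialHomeomorph C ℂ}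
    (hf : f ∈ IsManifold.maximalAtlas 𝓘(ℂ) ω C) {V : Submodule ℂ (HolOneForm ℂ C)} {p : C}
    (hp : p ∈ f.source) (α : V) :
    evalAt V p α = formCoeff f α.1.1 (f p) * chartDeriv f p (1 : ℂ) :=
  apply_eq_formCoeff_mul hf α.1.1 hp (1 : ℂ)

theorem exists_evalAt_ne_zero {V : Submodule ℂ (HolOneForm ℂ C)} (hV : basePoints V = ∅) (p : C) :
    ∃ α : V, evalAt V p α ≠ 0 := by
  by_contra! h
  exact evalAt_ne_zero (V := V) (p := p) (by simp [hV]) (LinearMap.ext h)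

/-- Two nonzero vectors are proportional exactly when all their 2 × 2 minors vanish; a form not
vanishing at `q` supplies the factor. -/
theorem formMap_eq_iff {V : Submodule ℂ (HolOneForm ℂ C)} (hV : basePoints V = ∅) {p q : C} :
    formMap V hV p = formMap V hV q ↔
      ∀ α β : V, evalAt V p α * evalAt V q β = evalAt V p β * evalAt V q α := by
  rw [formMap, formMap, Projectivization.mk_eq_mk_iff']
  constructor
  · rintro ⟨a, ha⟩ α β
    rw [← ha]
    simp only [LinearMap.smul_apply, smul_eq_mul]
    ring
  · intro h
    obtain ⟨β, hβ⟩ := exists_evalAt_ne_zero hV q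
    refine ⟨evalAt V p β / evalAt V q β, LinearMap.ext fun α => ?_⟩
    rw [LinearMap.smul_apply, smul_eq_mul, div_mul_eq_mul_div, div_eq_iff hβ, h α β]

/-- The scalar from the choice of representative and the factor from the chart both cancel. Where
the denominator is zero, both sides are zero by convention. -/
theorem affineCoord_formMap {V : Submodule ℂ (HolOneForm ℂ C)} (hV : basePoints V = ∅)
    {f : OpenPartialHomeomorph C ℂ} (hf : f ∈ IsManifold.maximalAtlas 𝓘(ℂ) ω C) {x : C}
    (hx : x ∈ f.source) (α₀ α : V) :
    affineCoord α₀ α (formMap V hV x) =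
      formCoeff f α.1.1 (f x) / formCoeff f α₀.1.1 (f x) := by
  obtain ⟨a, ha⟩ := Projectivization.exists_smul_eq_mk_rep ℂ (evalAt V x)
    (evalAt_ne_zero (by simp [hV]))
  rw [affineCoord, formMap, ← ha]
  change (a : ℂ) * evalAt V x α / ((a : ℂ) * evalAt V x α₀) = _
  rw [mul_div_mul_left _ _ a.ne_zero, evalAt_eq_formCoeff_mul hf hx,
    evalAt_eq_formCoeff_mul hf hx, mul_div_mul_right _ _ (chartDeriv_one_ne_zero hf hx)]

/-- By the quotient rule the numerator of the derivative is the Wronskian, and the differential of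
the chart is a nonzero factor. -/
theorem mfderiv_affineCoord_eq_zero_iff {V : Submodule ℂ (HolOneForm ℂ C)}
    (hV : basePoints V = ∅) {f : OpenPartialHomeomorph C ℂ}
    (hf : f ∈ IsManifold.maximalAtlas 𝓘(ℂ) ω C) {p : C} (hp : p ∈ f.source) (α₀ α : V)
    (h0 : formCoeff f α₀.1.1 (f p) ≠ 0) :
    mfderiv 𝓘(ℂ) 𝓘(ℂ) (fun x => affineCoord α₀ α (formMap V hV x)) p = 0 ↔
      formCoeff f α₀.1.1 (f p) * deriv (formCoeff f α.1.1) (f p) =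
        formCoeff f α.1.1 (f p) * deriv (formCoeff f α₀.1.1) (f p) := by
  have ht := f.open_target.mem_nhds (f.map_source hp)
  have hd := ((differentiableOn_formCoeff hf α.1).differentiableAt ht).hasDerivAt
  have hd0 := ((differentiableOn_formCoeff hf α₀.1).differentiableAt ht).hasDerivAt
  set d := (deriv (formCoeff f α.1.1) (f p) * formCoeff f α₀.1.1 (f p) -
    formCoeff f α.1.1 (f p) * deriv (formCoeff f α₀.1.1) (f p)) / formCoeff f α₀.1.1 (f p) ^ 2
    with hddef
  have hdiv : HasDerivAt (fun z => formCoeff f α.1.1 z / formCoeff f α₀.1.1 z) d (f p) :=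
    hd.div hd0 h0
  have h1 := hdiv.hasFDerivAt.hasMFDerivAt.comp p
    ((mdifferentiable_of_mem_maximalAtlas hf).mdifferentiableAt hp).hasMFDerivAt
  have h2 := h1.congr_of_eventuallyEq (f₁ := fun x => affineCoord α₀ α (formMap V hV x)) (by
    filter_upwards [f.open_source.mem_nhds hp] with x hx
    exact affineCoord_formMap hV hf hx α₀ α)
  have h3 : ∀ v : TangentSpace 𝓘(ℂ) p,
      mfderiv 𝓘(ℂ) 𝓘(ℂ) (fun x => affineCoord α₀ α (formMap V hV x)) p v =
        chartDeriv f p v * d := fun v => by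
    rw [h2.mfderiv]
    rfl
  have h4 : mfderiv 𝓘(ℂ) 𝓘(ℂ) (fun x => affineCoord α₀ α (formMap V hV x)) p = 0 ↔ d = 0 := by
    constructor
    · intro h
      have h5 := h3 (1 : ℂ)
      rw [h] at h5
      exact (mul_eq_zero.1 h5.symm).resolve_left (chartDeriv_one_ne_zero hf hp)
    · intro h
      refine ContinuousLinearMap.ext fun v => ?_
      refine (h3 v).trans ?_
      rw [h, mul_zero]
      rfl
  rw [h4, hddef, div_eq_zero_iff, or_iff_left (pow_ne_zero 2 h0), sub_eq_zero, mul_comm]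

theorem differentialVanishesAt_iff {V : Submodule ℂ (HolOneForm ℂ C)}
    (hV : basePoints V = ∅) {f : OpenPartialHomeomorph C ℂ}
    (hf : f ∈ IsManifold.maximalAtlas 𝓘(ℂ) ω C) {p : C} (hp : p ∈ f.source) :
    DifferentialVanishesAt V hV p ↔ ∀ α β : V,
      formCoeff f α.1.1 (f p) * deriv (formCoeff f β.1.1) (f p) =
        formCoeff f β.1.1 (f p) * deriv (formCoeff f α.1.1) (f p) := by
  constructor
  · intro h α β
    have key : ∀ α₀ α : V, formCoeff f α₀.1.1 (f p) ≠ 0 →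
        formCoeff f α₀.1.1 (f p) * deriv (formCoeff f α.1.1) (f p) =
          formCoeff f α.1.1 (f p) * deriv (formCoeff f α₀.1.1) (f p) := fun α₀ α h0 =>
      (mfderiv_affineCoord_eq_zero_iff hV hf hp α₀ α h0).1 (h α₀ α (by
        rw [evalAt_eq_formCoeff_mul hf hp]
        exact mul_ne_zero h0 (chartDeriv_one_ne_zero hf hp)))
    -- The differential is tested only with denominators nonzero at `p`. If one of the two forms is
    -- nonzero there, it can be the denominator, since the condition is symmetric; if both vanish,
    -- so does the Wronskian.
    by_cases ha : formCoeff f α.1.1 (f p) = 0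
    · by_cases hb : formCoeff f β.1.1 (f p) = 0
      · rw [ha, hb, zero_mul, zero_mul]
      · exact (key β α hb).symm
    · exact key α β ha
  · intro h α₀ α h0
    rw [evalAt_eq_formCoeff_mul hf hp] at h0
    exact (mfderiv_affineCoord_eq_zero_iff hV hf hp α₀ α (left_ne_zero_of_mul h0)).2 (h α₀ α)

end FormMap

/-! ### The base locus as nodes and cusps. -/

section BaseLocus

/-- Vanishing at a point is a linear condition, so the spanning wedge products suffice. -/
theorem mem_baseLocus_wedgeSquare_iff {E : Type*} [NormedAddCommGroup E] [NormedSpace ℂ E]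
    {M : Type*} [TopologicalSpace M] [ChartedSpace E M] {W : Submodule ℂ (HolOneForm E M)}
    {x : M} : x ∈ baseLocus (wedgeSquare W) ↔
      ∀ Ω ∈ W, ∀ Ω' ∈ W, OneForm.wedge Ω.1 Ω'.1 x = 0 := by
  constructor
  · intro h Ω hΩ Ω' hΩ'
    exact h (HolOneForm.wedge Ω Ω') (Submodule.subset_span ⟨Ω, hΩ, Ω', hΩ', rfl⟩)
  · intro h θ hθ
    refine Submodule.span_induction (p := fun θ _ => θ.1 x = 0) ?_ rfl ?_ ?_ hθ
    · rintro _ ⟨Ω, hΩ, Ω', hΩ', rfl⟩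
      exact h Ω hΩ Ω' hΩ'
    · intro θ θ' _ _ h1 h2
      change θ.1 x + θ'.1 x = 0
      rw [h1, h2, add_zero]
    · intro c θ _ h1
      change c • θ.1 x = 0
      rw [h1]
      exact smul_zero (A := E [⋀^Fin 2]→L[ℂ] ℂ) c

variable {C : Type*} [TopologicalSpace C] [ChartedSpace ℂ C] [IsManifold 𝓘(ℂ) ω C] [T2Space C]

/-- Passing from forms on `C₂` to all of `V` uses that every element of `V` has a corresponding
form, namely `symOneForm`. -/
theorem forall_symForms_iff {V : Submodule ℂ (HolOneForm ℂ C)} {D : Sym2 C}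
    {P : HolOneForm ℂ C → HolOneForm ℂ C → Prop}
    (hP : ∀ (Ω Ω' : HolOneForm (ℂ × ℂ) (Sym2 C)) (α β : HolOneForm ℂ C),
      Corresponds Ω α → Corresponds Ω' β → (OneForm.wedge Ω.1 Ω'.1 D = 0 ↔ P α β)) :
    D ∈ baseLocus (wedgeSquare (symForms V)) ↔ ∀ α β : V, P α β := by
  rw [mem_baseLocus_wedgeSquare_iff]
  constructor
  · intro h α β
    exact (hP _ _ _ _ (corresponds_symOneForm α.1) (corresponds_symOneForm β.1)).1
      (h _ ⟨α.1, α.2, corresponds_symOneForm α.1⟩ _ ⟨β.1, β.2, corresponds_symOneForm β.1⟩)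
  · rintro h Ω ⟨α, hα, hΩ⟩ Ω' ⟨β, hβ, hΩ'⟩
    exact (hP _ _ _ _ hΩ hΩ').2 (h ⟨α, hα⟩ ⟨β, hβ⟩)

theorem mk_mem_baseLocus_iff {V : Submodule ℂ (HolOneForm ℂ C)} {p q : C} (hpq : p ≠ q) :
    s(p, q) ∈ baseLocus (wedgeSquare (symForms V)) ↔
      ∀ α β : V, evalAt V p α * evalAt V q β = evalAt V p β * evalAt V q α := by
  obtain ⟨f, hf, hp, hq⟩ := SymSq.exists_chart_of_pair p q
  rw [forall_symForms_iff fun Ω Ω' α β h h' => wedge_mk_eq_zero_iff hf hp hq hpq h h']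
  refine forall_congr' fun α => forall_congr' fun β => ?_
  rw [evalAt_eq_formCoeff_mul hf hp, evalAt_eq_formCoeff_mul hf hp, evalAt_eq_formCoeff_mul hf hq,
    evalAt_eq_formCoeff_mul hf hq, mul_mul_mul_comm, mul_mul_mul_comm (formCoeff f β.1.1 (f p)),
    mul_left_inj' (mul_ne_zero (chartDeriv_one_ne_zero hf hp) (chartDeriv_one_ne_zero hf hq))]

theorem diag_mem_baseLocus_iff (V : Submodule ℂ (HolOneForm ℂ C)) (p : C) :
    ∃ f ∈ IsManifold.maximalAtlas 𝓘(ℂ) ω C, p ∈ f.source ∧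
      (s(p, p) ∈ baseLocus (wedgeSquare (symForms V)) ↔ ∀ α β : V,
        formCoeff f α.1.1 (f p) * deriv (formCoeff f β.1.1) (f p) =
          formCoeff f β.1.1 (f p) * deriv (formCoeff f α.1.1) (f p)) := by
  obtain ⟨f, hf, hp, h⟩ := wedge_diag_eq_zero_iff p
  exact ⟨f, hf, hp, forall_symForms_iff h⟩

theorem mk_mem_baseLocus_of_mem_basePoints {V : Submodule ℂ (HolOneForm ℂ C)} {p : C}
    (hp : p ∈ basePoints V) (q : C) : s(p, q) ∈ baseLocus (wedgeSquare (symForms V)) := by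
  by_cases hpq : p = q
  · subst hpq
    obtain ⟨f, hf, hpf, h⟩ := diag_mem_baseLocus_iff V p
    refine h.2 fun α β => ?_
    rw [(form_eq_zero_iff hf α.1.1 hpf).1 (hp α.1 α.2),
      (form_eq_zero_iff hf β.1.1 hpf).1 (hp β.1 β.2), zero_mul, zero_mul]
  · refine (mk_mem_baseLocus_iff hpq).2 fun α β => ?_
    have h0 : ∀ α : V, evalAt V p α = 0 := fun α =>
      congrArg (fun L => L (1 : ℂ)) (hp α.1 α.2)
    rw [h0, h0, zero_mul, zero_mul]

theorem baseLocus_eq_nodes_union_cusps {V : Submodule ℂ (HolOneForm ℂ C)}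
    (hV : basePoints V = ∅) :
    baseLocus (wedgeSquare (symForms V)) =
      {D : Sym2 C | ∃ p q : C, p ≠ q ∧ formMap V hV p = formMap V hV q ∧ D = s(p, q)} ∪
      {D : Sym2 C | ∃ p : C, DifferentialVanishesAt V hV p ∧ D = s(p, p)} := by
  have hdiag : ∀ p : C, s(p, p) ∈ baseLocus (wedgeSquare (symForms V)) ↔
      DifferentialVanishesAt V hV p := fun p => by
    obtain ⟨f, hf, hp, h⟩ := diag_mem_baseLocus_iff V p
    rw [h, differentialVanishesAt_iff hV hf hp]
  ext D
  constructor
  · intro hD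
    induction D with | h p q => ?_
    by_cases hpq : p = q
    · subst hpq
      exact Or.inr ⟨p, (hdiag p).1 hD, rfl⟩
    · exact Or.inl ⟨p, q, hpq, (formMap_eq_iff hV).2 ((mk_mem_baseLocus_iff hpq).1 hD), rfl⟩
  · rintro (⟨p, q, hpq, h, rfl⟩ | ⟨p, h, rfl⟩)
    · exact (mk_mem_baseLocus_iff hpq).2 ((formMap_eq_iff hV).1 h)
    · exact (hdiag p).2 h

end BaseLocus

/-! ### Finiteness of nodes and cusps. -/

section Finiteness

variable {C : Type*} [TopologicalSpace C] [T2Space C] [ChartedSpace ℂ C]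

omit [T2Space C] in
theorem neBot_nhdsNE_of_chartedSpace (x : C) : (𝓝[≠] x).NeBot := by
  by_contra h
  have ho : IsOpen ({x} : Set C) := isOpen_singleton_iff_punctured_nhds x |>.2
    (Filter.not_neBot.1 h)
  have h1 := (chartAt ℂ x).isOpen_image_of_subset_source ho
    (singleton_subset_iff.2 (mem_chart_source ℂ x))
  rw [image_singleton] at h1
  exact not_isOpen_singleton _ h1

/-- A neighbourhood of a point is infinite, so it stays infinite after removal of the finite
exceptional set, where the map is injective. -/
theorem not_eventually_eq_of_isBirationalOntoImage {P : Type*} {φ : C → P}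
    (hφ : IsBirationalOntoImage φ) (x : C) (c : P) : ¬ ∀ᶠ y in 𝓝 x, φ y = c := by
  obtain ⟨S, hS, hinj⟩ := hφ
  intro h
  have := neBot_nhdsNE_of_chartedSpace x
  have hinf : ({y | φ y = c} \ S).Infinite := (infinite_of_mem_nhds x h).sdiff hS
  refine hinf (Set.Finite.of_finite_image ((finite_singleton c).subset ?_)
    (hinj.mono fun y hy => hy.2))
  rintro _ ⟨y, hy, rfl⟩
  exact hy.1

omit [T2Space C] [ChartedSpace ℂ C] in
/-- Near an accumulation point of its zeros, a function that is holomorphic in a disc of a chart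
vanishes on this disc. -/
theorem eqOn_zero_of_accPt {f : OpenPartialHomeomorph C ℂ} {x : C} (hx : x ∈ f.source) {r : ℝ}
    (hr : 0 < r) {K : Set C} (hK : AccPt x (Filter.principal K)) {g : ℂ → ℂ}
    (hg : DifferentiableOn ℂ g (Metric.ball (f x) r)) (h0 : ∀ y ∈ K, y ∈ f.source → g (f y) = 0) :
    EqOn g 0 (Metric.ball (f x) r) := by
  refine (hg.analyticOnNhd Metric.isOpen_ball).eqOn_zero_of_preconnected_of_frequently_eq_zero
    (convex_ball (f x) r).isPreconnected (Metric.mem_ball_self hr) ?_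
  rw [accPt_iff_frequently_nhdsNE] at hK
  have ht : Filter.Tendsto f (𝓝[≠] x) (𝓝[≠] (f x)) := by
    refine tendsto_nhdsWithin_iff.2 ⟨(f.continuousAt hx).tendsto.mono_left nhdsWithin_le_nhds, ?_⟩
    filter_upwards [self_mem_nhdsWithin, mem_nhdsWithin_of_mem_nhds (f.open_source.mem_nhds hx)]
      with y hy hys h
    exact hy (f.injOn hys hx h)
  refine ht.frequently ((hK.and_eventually (mem_nhdsWithin_of_mem_nhds
    (f.open_source.mem_nhds hx))).mono fun y hy => h0 y hy.1 hy.2)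

variable [IsManifold 𝓘(ℂ) ω C] {V : Submodule ℂ (HolOneForm ℂ C)}

/-- With `p` fixed, the minors are linear in the coefficients at the other point, hence holomorphic
there. If the fibre accumulates at `x`, they vanish near `x` and φ_V is constant there. -/
theorem finite_fibre [CompactSpace C] (hV : basePoints V = ∅)
    (hbir : IsBirationalOntoImage (formMap V hV)) (p : C) :
    {q : C | formMap V hV p = formMap V hV q}.Finite := by
  by_contra hinf
  obtain ⟨x, hx⟩ := Set.Infinite.exists_accPt_principal hinf
  let f := chartAt ℂ x
  have hf : f ∈ IsManifold.maximalAtlas 𝓘(ℂ) ω C := IsManifold.chart_mem_maximalAtlas x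
  have hxf : x ∈ f.source := mem_chart_source ℂ x
  obtain ⟨r, hr, hball⟩ := Metric.isOpen_iff.1 f.open_target (f x) (f.map_source hxf)
  refine not_eventually_eq_of_isBirationalOntoImage hbir x (formMap V hV p) ?_
  filter_upwards [f.open_source.mem_nhds hxf,
    (f.continuousAt hxf).preimage_mem_nhds (Metric.ball_mem_nhds _ hr)] with y hy hyb
  refine ((formMap_eq_iff hV).2 fun α β => ?_).symm
  have h := eqOn_zero_of_accPt hxf hr hx
    (g := fun z => evalAt V p α * formCoeff f β.1.1 z - evalAt V p β * formCoeff f α.1.1 z)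
    ((((differentiableOn_formCoeff hf β.1).mono hball).const_mul _).sub
      (((differentiableOn_formCoeff hf α.1).mono hball).const_mul _))
    (fun q hq hqf => by
      have h1 := (formMap_eq_iff hV).1 hq α β
      rw [evalAt_eq_formCoeff_mul hf hqf, evalAt_eq_formCoeff_mul hf hqf] at h1
      refine mul_right_cancel₀ (chartDeriv_one_ne_zero hf hqf) ?_
      linear_combination h1) hyb
  have h' : evalAt V p α * formCoeff f β.1.1 (f y) - evalAt V p β * formCoeff f α.1.1 (f y) = 0 := h
  rw [evalAt_eq_formCoeff_mul hf hy, evalAt_eq_formCoeff_mul hf hy]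
  linear_combination chartDeriv f y (1 : ℂ) * h'

/-- If cusps accumulate at `x`, all Wronskians vanish near `x`. Then every coefficient is a constant
multiple of that of one form `α₀` without zeros nearby, so φ_V is constant near `x`. -/
theorem finite_cusps [CompactSpace C] (hV : basePoints V = ∅)
    (hbir : IsBirationalOntoImage (formMap V hV)) :
    {p : C | DifferentialVanishesAt V hV p}.Finite := by
  by_contra hinf
  obtain ⟨x, hx⟩ := Set.Infinite.exists_accPt_principal hinf
  let f := chartAt ℂ x
  have hf : f ∈ IsManifold.maximalAtlas 𝓘(ℂ) ω C := IsManifold.chart_mem_maximalAtlas x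
  have hxf : x ∈ f.source := mem_chart_source ℂ x
  obtain ⟨α₀, hα₀⟩ := exists_evalAt_ne_zero hV x
  rw [evalAt_eq_formCoeff_mul hf hxf] at hα₀
  have hc : ContinuousAt (formCoeff f α₀.1.1) (f x) :=
    (differentiableOn_formCoeff hf α₀.1).continuousOn.continuousAt
      (f.open_target.mem_nhds (f.map_source hxf))
  -- The disc is small enough for `α₀` to have no zeros on it, so that quotients by its coefficient
  -- are holomorphic.
  obtain ⟨r, hr, hball'⟩ := Metric.eventually_nhds_iff_ball.1
    ((f.open_target.eventually_mem (f.map_source hxf)).and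
      (hc.eventually_ne (left_ne_zero_of_mul hα₀)))
  have hball : Metric.ball (f x) r ⊆ f.target := fun z hz => (hball' z hz).1
  have hcoeff : ∀ α : V, DifferentiableOn ℂ (formCoeff f α.1.1) (Metric.ball (f x) r) :=
    fun α => (differentiableOn_formCoeff hf α.1).mono hball
  have hconst : ∀ α : V, ∃ c : ℂ, ∀ z ∈ Metric.ball (f x) r,
      formCoeff f α.1.1 z = c * formCoeff f α₀.1.1 z := by
    intro α
    have hw := eqOn_zero_of_accPt hxf hr hx
      (g := fun z => formCoeff f α₀.1.1 z * deriv (formCoeff f α.1.1) z -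
        formCoeff f α.1.1 z * deriv (formCoeff f α₀.1.1) z)
      (((hcoeff α₀).mul ((hcoeff α).deriv Metric.isOpen_ball)).sub
        ((hcoeff α).mul ((hcoeff α₀).deriv Metric.isOpen_ball)))
      (fun q hq hqf => sub_eq_zero.2 ((differentialVanishesAt_iff hV hf hqf).1 hq α₀ α))
    have hd : ∀ z ∈ Metric.ball (f x) r,
        HasDerivAt (fun z => formCoeff f α.1.1 z / formCoeff f α₀.1.1 z) 0 z := by
      intro z hz
      have hzn := Metric.isOpen_ball.mem_nhds hz
      have h1 := ((hcoeff α).differentiableAt hzn).hasDerivAt.div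
        ((hcoeff α₀).differentiableAt hzn).hasDerivAt (hball' z hz).2
      have h2 : formCoeff f α₀.1.1 z * deriv (formCoeff f α.1.1) z -
        formCoeff f α.1.1 z * deriv (formCoeff f α₀.1.1) z = 0 := hw hz
      rw [mul_comm (formCoeff f α₀.1.1 z)] at h2
      rwa [h2, zero_div] at h1
    obtain ⟨c, hc⟩ := Metric.isOpen_ball.exists_is_const_of_deriv_eq_zero
      (convex_ball (f x) r).isPreconnected
      (fun z hz => (hd z hz).differentiableAt.differentiableWithinAt) (fun z hz => (hd z hz).deriv)
    exact ⟨c, fun z hz => (div_eq_iff (hball' z hz).2).1 (hc z hz)⟩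
  refine not_eventually_eq_of_isBirationalOntoImage hbir x (formMap V hV x) ?_
  filter_upwards [f.open_source.mem_nhds hxf,
    (f.continuousAt hxf).preimage_mem_nhds (Metric.ball_mem_nhds _ hr)] with y hy hyb
  refine (formMap_eq_iff hV).2 fun α β => ?_
  obtain ⟨a, ha⟩ := hconst α
  obtain ⟨b, hb⟩ := hconst β
  rw [evalAt_eq_formCoeff_mul hf hy, evalAt_eq_formCoeff_mul hf hy, evalAt_eq_formCoeff_mul hf hxf,
    evalAt_eq_formCoeff_mul hf hxf, ha _ hyb, hb _ hyb, ha _ (Metric.mem_ball_self hr),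
    hb _ (Metric.mem_ball_self hr)]
  ring

theorem finite_nodes [CompactSpace C] (hV : basePoints V = ∅)
    (hbir : IsBirationalOntoImage (formMap V hV)) :
    {D : Sym2 C | ∃ p q : C, p ≠ q ∧ formMap V hV p = formMap V hV q ∧ D = s(p, q)}.Finite := by
  obtain ⟨S, hS, hinj⟩ := id hbir
  -- Two distinct points with the same image cannot both lie outside `S`, so each node belongs to
  -- the fibre of a point of `S`.
  refine (hS.biUnion fun p _ => (finite_fibre hV hbir p).image fun q => s(p, q)).subset ?_
  rintro _ ⟨p, q, hpq, h, rfl⟩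
  by_cases hp : p ∈ S
  · exact mem_biUnion hp ⟨q, h, rfl⟩
  · by_cases hq : q ∈ S
    · exact mem_biUnion hq ⟨p, h.symm, Sym2.eq_swap⟩
    · exact absurd (hinj hp hq h) hpq

end Finiteness

theorem proposition3p2 {C : Type*} [TopologicalSpace C] [T2Space C] [CompactSpace C]
    [ConnectedSpace C] [ChartedSpace ℂ C] [IsManifold 𝓘(ℂ) ω C]
    (V : Submodule ℂ (HolOneForm ℂ C)) (hdim : Module.finrank ℂ V = 3) :
    (∀ p ∈ basePoints V,
      {D : Sym2 C | ∃ q : C, D = s(p, q)} ⊆ baseLocus (wedgeSquare (symForms V))) ∧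
    (∀ hV : basePoints V = ∅, IsBirationalOntoImage (formMap V hV) →
      (baseLocus (wedgeSquare (symForms V))).Finite ∧
      baseLocus (wedgeSquare (symForms V)) =
        {D : Sym2 C | ∃ p q : C, p ≠ q ∧ formMap V hV p = formMap V hV q ∧ D = s(p, q)} ∪
        {D : Sym2 C | ∃ p : C, DifferentialVanishesAt V hV p ∧ D = s(p, p)}) := by
  refine ⟨?_, fun hV hbir => ⟨?_, baseLocus_eq_nodes_union_cusps hV⟩⟩
  · rintro p hp _ ⟨q, rfl⟩
    exact mk_mem_baseLocus_of_mem_basePoints hp q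
  · rw [baseLocus_eq_nodes_union_cusps hV]
    refine (finite_nodes hV hbir).union (((finite_cusps hV hbir).image fun p => s(p, p)).subset ?_)
    rintro _ ⟨p, hp, rfl⟩
    exact ⟨p, hp, rfl⟩
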